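/- Let $d\in\mathbb{N}$, let $\varrho_0,\varrho_1:\mathbb{R}^d\to[0,\infty)$ be measurable, put $\varrho=\varrho_0\varrho_1$ and assume $0<\int_{\mathbb{R}^d}\varrho(x)\,dx<\infty$. Let $\pi$ be the probability measure on $\mathbb{R}^d$ with (possibly unnormalized) Lebesgue density $\varrho$, i.e. $\pi(A)=\int_A\varrho(x)\,dx\big/\int_{\mathbb{R}^d}\varrho(x)\,dx$ for Borel $A$. *Slice sampler.* Let $P_\pi$ be the Markov kernel that moves from $x$ to $y$ as follows: draw $t$ uniformly from $(0,\varrho_1(x))$; then draw $y$ from the distribution $$\mu_t(A)=\frac{\int_A\varrho_0(z)\,\mathbb{1}\{\varrho_1(z)>t\}\,dz}{\int_{\mathbb{R}^d}\varrho_0(z)\,\mathbb{1}\{\varrho_1(z)>t\}\,dz}.$$ (These two steps are well defined for $\pi$-almost every $x$; from the remaining points the chain stays where it is. The measure $\pi$ is invariant under $P_\pi$.) *Spectral gap.* For a Markov kernel $P$ with invariant distribution $\nu$ put $\mathrm{gap}_\nu(P)=1-\|P-\nu\|_{L_2(\nu)\to L_2(\nu)}$, where $(Pg)(x)=\int g(y)\,P(x,dy)$,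 the measure $\nu$ acts by $g\mapsto\int g\,d\nu$ (a constant function), and $\|\cdot\|_{L_2(\nu)\to L_2(\nu)}$ is the operator norm. *The class $\Lambda_k$.* For real $k>0$, $\Lambda_k$ is the class of continuous functions $\ell:(0,\infty)\to[0,\infty)$ such that (i) $\lim_{t\to\infty}\ell(t)=0$, and $\sup\ell:=\lim_{t\searrow0}\ell(t)$ exists in $(0,\infty]$; (ii) $\ell$ is strictly decreasing on the interval $\mathrm{supp}(\ell):=\bigl(0,\sup\{t>0:\ell(t)>0\}\bigr)$; (iii) the function $r\mapsto\ell^{-1}(r^k)$ is log-concave on $\bigl(0,(\sup\ell)^{1/k}\bigr)$, where $\ell^{-1}:(0,\sup\ell)\to\mathrm{supp}(\ell)$ is the inverse of the restriction of $\ell$ to $\mathrm{supp}(\ell)$. **Theorem.** Let $\ell_{\varrho_0,\varrho_1}(t)=\int_{\mathbb{R}^d}\varrho_0(x)\,\mathbb{1}\{\varrho_1(x)>t\}\,dx$ for $t>0$. If $\ell_{\varrho_0,\varrho_1}\in\Lambda_k$ for some real $k>0$, then $$\mathrm{gap}_\pi(P_\pi)\ \ge\ \frac{1}{k+1}.$$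 -/

import Mathlib

open MeasureTheory ProbabilityTheory Set Filter Topology
open scoped NNReal ENNReal

noncomputable section

namespace SliceSampling

/-! ### The spectral gap of a Markov kernel -/

/-- The norm of `P - ν` as an operator on `L₂(ν)`, where `(P g) x = ∫ g(y) P(x, dy)` and the
measure `ν` acts by `g ↦ ∫ g dν`: the supremum of `‖P g - ν g‖₂` over all `g` in the unit ball
of `L₂(ν)`. It takes values in `[0, ∞]`, so that an unbounded operator has norm `∞`. -/
def deviationNorm {G : Type*} [MeasurableSpace G] (ν : Measure G) (P : Kernel G G) : ℝ≥0∞ :=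
  ⨆ (g : G → ℝ) (_ : MemLp g 2 ν) (_ : eLpNorm g 2 ν ≤ 1),
    eLpNorm (fun x => (∫ y, g y ∂(P x)) - ∫ y, g y ∂ν) 2 ν

/-- The spectral gap `1 - ‖P - ν‖` of a Markov kernel `P` with invariant distribution `ν`, as an
extended real number. -/
def spectralGap {G : Type*} [MeasurableSpace G] (ν : Measure G) (P : Kernel G G)
    [IsMarkovKernel P] : EReal :=
  1 - (deviationNorm ν P : EReal)

/-! ### Targets with an unnormalized density -/

/-- `ϱ` is a (possibly unnormalized) Lebesgue density of `π`. -/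
structure HasDensity {d : ℕ} (π : Measure (EuclideanSpace ℝ (Fin d)))
    (ϱ : EuclideanSpace ℝ (Fin d) → ℝ≥0) : Prop where
  measurable : Measurable ϱ
  lintegral_ne_zero : ∫⁻ x, (ϱ x : ℝ≥0∞) ≠ 0
  lintegral_ne_top : ∫⁻ x, (ϱ x : ℝ≥0∞) ≠ ∞
  eq_withDensity :
    π = (∫⁻ x, (ϱ x : ℝ≥0∞))⁻¹ • (volume.withDensity fun x => (ϱ x : ℝ≥0∞))

/-! ### The generalized level set function -/

section LevelSets

variable {d : ℕ} (ϱ₀ ϱ₁ : EuclideanSpace ℝ (Fin d) → ℝ≥0)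

/-- `∫ ϱ₀(x) 𝟙{ϱ₁(x) > t} dx`, with values in `[0, ∞]`. -/
def sliceMass (t : ℝ) : ℝ≥0∞ :=
  ∫⁻ x in {x | t < (ϱ₁ x : ℝ)}, (ϱ₀ x : ℝ≥0∞)

/-- The generalized level set function `t ↦ ∫ ϱ₀(x) 𝟙{ϱ₁(x) > t} dx`, for `t > 0`. The integral
is finite, see `sliceMass_ne_top`. -/
def levelFun (t : ℝ) : ℝ := (sliceMass ϱ₀ ϱ₁ t).toReal

end LevelSets

/-- The interval `(0, sup {t > 0 | ℓ t > 0})`; the supremum may be infinite. -/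
def levelSupp (ℓ : ℝ → ℝ) : Set ℝ :=
  {t | 0 < t ∧ ENNReal.ofReal t < ⨆ s ∈ {s : ℝ | 0 < s ∧ 0 < ℓ s}, ENNReal.ofReal s}

/-- The inverse of the restriction of `ℓ` to `levelSupp ℓ`. -/
def levelInv (ℓ : ℝ → ℝ) : ℝ → ℝ := Function.invFunOn ℓ (levelSupp ℓ)

/-- The class `Λ_k` of functions `ℓ : (0, ∞) → [0, ∞)`; only the values of `ℓ` on `(0, ∞)` matter.
In the last condition `S` is the limit of `ℓ` at `0` from the right (possibly `∞`), also denoted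
`sup ℓ`, and the function `r ↦ ℓ⁻¹(r ^ k)` is required to be log-concave on `(0, S ^ (1 / k))`. The
other conditions make `ℓ` a bijection from `levelSupp ℓ` onto `(0, S)`. -/
structure MemLambda (k : ℝ) (ℓ : ℝ → ℝ) : Prop where
  nonneg : ∀ t, 0 < t → 0 ≤ ℓ t
  continuousOn : ContinuousOn ℓ (Ioi 0)
  tendsto_atTop : Tendsto ℓ atTop (𝓝 0)
  strictAntiOn : StrictAntiOn ℓ (levelSupp ℓ)
  logConcave : ∃ S : ℝ≥0∞, 0 < S ∧
    Tendsto (fun t => ENNReal.ofReal (ℓ t)) (𝓝[>] 0) (𝓝 S) ∧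
    ConcaveOn ℝ {r : ℝ | 0 < r ∧ ENNReal.ofReal r < S ^ (1 / k)}
      (fun r => Real.log (levelInv ℓ (r ^ k)))

/-! ### The slice sampler -/

section Sampler

variable {d : ℕ} (ϱ₀ ϱ₁ : EuclideanSpace ℝ (Fin d) → ℝ≥0)

/-- First step: from `x`, draw the threshold `t` uniformly from `(0, ϱ₁ x)`. -/
def thresholdKernel : Kernel (EuclideanSpace ℝ (Fin d)) ℝ :=
  Kernel.withDensity (Kernel.const _ volume) fun x t =>
    (ϱ₁ x : ℝ≥0∞)⁻¹ * (Ioo (0 : ℝ) (ϱ₁ x)).indicator (fun _ => 1) t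

/-- Second step: from `t`, draw the new point from the distribution with unnormalized density
`y ↦ ϱ₀(y) 𝟙{ϱ₁(y) > t}`. -/
def updateKernel : Kernel ℝ (EuclideanSpace ℝ (Fin d)) :=
  Kernel.withDensity (Kernel.const _ volume) fun t y =>
    (sliceMass ϱ₀ ϱ₁ t)⁻¹ * {y | t < (ϱ₁ y : ℝ)}.indicator (fun y => (ϱ₀ y : ℝ≥0∞)) y

/-- The two steps in succession. For points `x` with `ϱ₁ x = 0`, or for which slices of zero
`ϱ₀`-mass are drawn with positive probability, the two steps are not well defined and this is not a
probability measure; such points form a null set for the target. -/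
def sliceStep : Kernel (EuclideanSpace ℝ (Fin d)) (EuclideanSpace ℝ (Fin d)) :=
  updateKernel ϱ₀ ϱ₁ ∘ₖ thresholdKernel ϱ₁

theorem measurableSet_goodPoints : MeasurableSet {x | sliceStep ϱ₀ ϱ₁ x univ = 1} :=
  (Kernel.measurable_coe _ MeasurableSet.univ) (measurableSet_singleton 1)

open Classical in
/-- The transition kernel of the slice sampler. On the exceptional null set where the two steps are
not well defined, the chain stays where it is. -/
def sliceKernel : Kernel (EuclideanSpace ℝ (Fin d)) (EuclideanSpace ℝ (Fin d)) :=
  Kernel.piecewise (measurableSet_goodPoints ϱ₀ ϱ₁) (sliceStep ϱ₀ ϱ₁) Kernel.id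

instance : IsMarkovKernel (sliceKernel ϱ₀ ϱ₁) := by
  refine ⟨fun x => ⟨?_⟩⟩
  rw [sliceKernel, Kernel.piecewise_apply]
  split_ifs with h
  · exact h
  · exact measure_univ

variable {ϱ₀ ϱ₁}

theorem measurableSet_slice (h₁ : Measurable ϱ₁) (t : ℝ) :
    MeasurableSet {y | t < (ϱ₁ y : ℝ)} :=
  measurableSet_lt measurable_const h₁.coe_nnreal_real

theorem sliceMass_eq (h₁ : Measurable ϱ₁) (t : ℝ) :
    sliceMass ϱ₀ ϱ₁ t
      = ∫⁻ y, {y | t < (ϱ₁ y : ℝ)}.indicator (fun y => (ϱ₀ y : ℝ≥0∞)) y := by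
  rw [lintegral_indicator (measurableSet_slice h₁ t)]
  rfl

theorem measurable_sliceInd (h₀ : Measurable ϱ₀) (h₁ : Measurable ϱ₁) :
    Measurable fun p : ℝ × EuclideanSpace ℝ (Fin d) =>
      {y | p.1 < (ϱ₁ y : ℝ)}.indicator (fun y => (ϱ₀ y : ℝ≥0∞)) p.2 := by
  have hs : MeasurableSet {p : ℝ × EuclideanSpace ℝ (Fin d) | p.1 < (ϱ₁ p.2 : ℝ)} :=
    measurableSet_lt measurable_fst (h₁.coe_nnreal_real.comp measurable_snd)
  exact (((h₀.comp measurable_snd).coe_nnreal_ennreal).indicator hs)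

theorem measurable_sliceMass (h₀ : Measurable ϱ₀) (h₁ : Measurable ϱ₁) :
    Measurable (sliceMass ϱ₀ ϱ₁) := by
  have : sliceMass ϱ₀ ϱ₁ = fun t =>
      ∫⁻ y, {y | t < (ϱ₁ y : ℝ)}.indicator (fun y => (ϱ₀ y : ℝ≥0∞)) y :=
    funext (sliceMass_eq h₁)
  rw [this]
  exact (measurable_sliceInd h₀ h₁).lintegral_prod_right'

theorem sliceMass_ne_top (h₁ : Measurable ϱ₁)
    (hint : ∫⁻ x, (ϱ₀ x : ℝ≥0∞) * ϱ₁ x ≠ ∞) {t : ℝ} (ht : 0 < t) :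
    sliceMass ϱ₀ ϱ₁ t ≠ ∞ := by
  have h : ENNReal.ofReal t * sliceMass ϱ₀ ϱ₁ t ≤ ∫⁻ x, (ϱ₀ x : ℝ≥0∞) * ϱ₁ x := by
    rw [sliceMass_eq h₁, ← lintegral_const_mul' _ _ ENNReal.ofReal_ne_top]
    refine lintegral_mono fun y => ?_
    by_cases hy : t < (ϱ₁ y : ℝ)
    · rw [indicator_of_mem (by exact hy), mul_comm]
      gcongr
      rw [← ENNReal.ofReal_coe_nnreal]
      exact ENNReal.ofReal_le_ofReal hy.le
    · rw [indicator_of_notMem (by exact hy)]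
      simp
  intro htop
  rw [htop, ENNReal.mul_top (by simpa using ht)] at h
  exact hint (top_le_iff.1 h)

theorem thresholdKernel_apply (h₁ : Measurable ϱ₁) (x : EuclideanSpace ℝ (Fin d)) :
    thresholdKernel ϱ₁ x = (ϱ₁ x : ℝ≥0∞)⁻¹ • volume.restrict (Ioo (0 : ℝ) (ϱ₁ x)) := by
  have hs : MeasurableSet {p : EuclideanSpace ℝ (Fin d) × ℝ | 0 < p.2 ∧ p.2 < (ϱ₁ p.1 : ℝ)} :=
    (measurableSet_lt measurable_const measurable_snd).inter
      (measurableSet_lt measurable_snd (h₁.coe_nnreal_real.comp measurable_fst))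
  have hm : Measurable (Function.uncurry fun (x : EuclideanSpace ℝ (Fin d)) (t : ℝ) =>
      (ϱ₁ x : ℝ≥0∞)⁻¹ * (Ioo (0 : ℝ) (ϱ₁ x)).indicator (fun _ => (1 : ℝ≥0∞)) t) :=
    ((h₁.comp measurable_fst).coe_nnreal_ennreal.inv).mul (measurable_const.indicator hs)
  rw [thresholdKernel, Kernel.withDensity_apply _ hm, Kernel.const_apply]
  have := withDensity_smul (μ := (volume : Measure ℝ)) (ϱ₁ x : ℝ≥0∞)⁻¹
    ((measurable_const (a := (1 : ℝ≥0∞))).indicator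
      (measurableSet_Ioo (a := (0 : ℝ)) (b := (ϱ₁ x : ℝ))))
  rw [withDensity_indicator measurableSet_Ioo, withDensity_const, one_smul] at this
  exact this

theorem updateKernel_apply (h₀ : Measurable ϱ₀) (h₁ : Measurable ϱ₁) (t : ℝ) :
    updateKernel ϱ₀ ϱ₁ t = (sliceMass ϱ₀ ϱ₁ t)⁻¹ •
      (volume.restrict {y | t < (ϱ₁ y : ℝ)}).withDensity fun y => (ϱ₀ y : ℝ≥0∞) := by
  have hm : Measurable (Function.uncurry fun (t : ℝ) (y : EuclideanSpace ℝ (Fin d)) =>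
      (sliceMass ϱ₀ ϱ₁ t)⁻¹ * {y | t < (ϱ₁ y : ℝ)}.indicator (fun y => (ϱ₀ y : ℝ≥0∞)) y) :=
    ((measurable_sliceMass h₀ h₁).comp measurable_fst).inv.mul (measurable_sliceInd h₀ h₁)
  rw [updateKernel, Kernel.withDensity_apply _ hm, Kernel.const_apply]
  have := withDensity_smul (μ := (volume : Measure (EuclideanSpace ℝ (Fin d))))
    (sliceMass ϱ₀ ϱ₁ t)⁻¹ (h₀.coe_nnreal_ennreal.indicator (measurableSet_slice h₁ t))
  rw [withDensity_indicator (measurableSet_slice h₁ t)] at this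
  exact this

end Sampler

section Invariance

variable {d : ℕ} {ϱ₀ ϱ₁ : EuclideanSpace ℝ (Fin d) → ℝ≥0}

theorem lintegral_thresholdKernel (h₁ : Measurable ϱ₁) (x : EuclideanSpace ℝ (Fin d))
    {f : ℝ → ℝ≥0∞} :
    (ϱ₁ x : ℝ≥0∞) * ∫⁻ t, f t ∂(thresholdKernel ϱ₁ x)
      = ∫⁻ t in Ioi (0 : ℝ), {y | t < (ϱ₁ y : ℝ)}.indicator (fun _ => f t) x := by
  have hI : ∫⁻ t in Ioi (0 : ℝ), {y | t < (ϱ₁ y : ℝ)}.indicator (fun _ => f t) x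
      = ∫⁻ t in Ioo (0 : ℝ) (ϱ₁ x), f t := by
    rw [← Ioi_inter_Iio, inter_comm, ← Measure.restrict_restrict measurableSet_Iio,
      ← lintegral_indicator measurableSet_Iio]
    rfl
  rw [thresholdKernel_apply h₁, lintegral_smul_measure, hI, smul_eq_mul]
  by_cases h : ϱ₁ x = 0
  · simp [h]
  · rw [← mul_assoc, ENNReal.mul_inv_cancel (by simpa using h) ENNReal.coe_ne_top, one_mul]

/-- The target is invariant under the two steps of the slice sampler. -/
theorem sliceStep_bind {π : Measure (EuclideanSpace ℝ (Fin d))}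
    {ϱ : EuclideanSpace ℝ (Fin d) → ℝ≥0} (h₀ : Measurable ϱ₀) (h₁ : Measurable ϱ₁)
    (hfac : ∀ x, ϱ x = ϱ₀ x * ϱ₁ x) (hπ : HasDensity π ϱ) :
    π.bind (sliceStep ϱ₀ ϱ₁) = π := by
  have hint : ∫⁻ x, (ϱ₀ x : ℝ≥0∞) * ϱ₁ x ≠ ∞ := by
    simpa [hfac] using hπ.lintegral_ne_top
  have key : ∀ f : ℝ → ℝ≥0∞, Measurable f →
      ∫⁻ x, (ϱ x : ℝ≥0∞) * ∫⁻ t, f t ∂(thresholdKernel ϱ₁ x)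
        = ∫⁻ t in Ioi (0 : ℝ), f t * sliceMass ϱ₀ ϱ₁ t := by
    intro f hf
    have hm := (measurable_sliceInd h₀ h₁).mul (hf.comp measurable_fst)
    calc ∫⁻ x, (ϱ x : ℝ≥0∞) * ∫⁻ t, f t ∂(thresholdKernel ϱ₁ x)
        = ∫⁻ x, ∫⁻ t in Ioi (0 : ℝ),
            {y | t < (ϱ₁ y : ℝ)}.indicator (fun y => (ϱ₀ y : ℝ≥0∞)) x * f t := by
          refine lintegral_congr fun x => ?_
          rw [hfac, ENNReal.coe_mul, mul_assoc, lintegral_thresholdKernel h₁,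
            ← lintegral_const_mul' _ _ ENNReal.coe_ne_top]
          refine lintegral_congr fun t => ?_
          by_cases hx : t < (ϱ₁ x : ℝ) <;> simp [indicator, hx]
      _ = ∫⁻ t in Ioi (0 : ℝ), ∫⁻ x,
            {y | t < (ϱ₁ y : ℝ)}.indicator (fun y => (ϱ₀ y : ℝ≥0∞)) x * f t :=
          lintegral_lintegral_swap (hm.comp measurable_swap).aemeasurable
      _ = ∫⁻ t in Ioi (0 : ℝ), f t * sliceMass ϱ₀ ϱ₁ t := by
          refine lintegral_congr fun t => ?_
          rw [lintegral_mul_const _ (h₀.coe_nnreal_ennreal.indicator (measurableSet_slice h₁ t)),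
            ← sliceMass_eq h₁, mul_comm]
  have hint_eq : ∀ g : EuclideanSpace ℝ (Fin d) → ℝ≥0∞, Measurable g →
      ∫⁻ x, g x ∂π = (∫⁻ x, (ϱ x : ℝ≥0∞))⁻¹ * ∫⁻ x, (ϱ x : ℝ≥0∞) * g x := by
    intro g hg
    conv_lhs => rw [hπ.eq_withDensity]
    rw [lintegral_smul_measure,
      lintegral_withDensity_eq_lintegral_mul _ hπ.measurable.coe_nnreal_ennreal hg]
    rfl
  ext A hA
  have hUA : Measurable fun t => updateKernel ϱ₀ ϱ₁ t A := Kernel.measurable_coe _ hA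
  rw [Measure.bind_apply hA (Kernel.aemeasurable _),
    hint_eq _ (Kernel.measurable_coe _ hA)]
  simp only [sliceStep, Kernel.comp_apply' _ _ _ hA]
  rw [key _ hUA, ← lintegral_indicator_one hA, hint_eq _ (measurable_one.indicator hA)]
  congr 1
  have hstep : ∀ x, (ϱ x : ℝ≥0∞) * A.indicator 1 x
      = ∫⁻ t in Ioi (0 : ℝ), {y | t < (ϱ₁ y : ℝ)}.indicator (fun y => (ϱ₀ y : ℝ≥0∞)) x
          * A.indicator 1 x := by
    intro x
    have h := (lintegral_const_mul' (μ := volume.restrict (Ioi (0 : ℝ)))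
      ((ϱ₀ x : ℝ≥0∞) * A.indicator 1 x)
      (fun t => {y | t < (ϱ₁ y : ℝ)}.indicator (fun _ => (1 : ℝ≥0∞)) x)
      (by by_cases hx : x ∈ A <;> simp [hx]))
    have h2 : ∫⁻ t in Ioi (0 : ℝ), {y | t < (ϱ₁ y : ℝ)}.indicator (fun _ => (1 : ℝ≥0∞)) x
        = (ϱ₁ x : ℝ≥0∞) := by
      have : ∀ t, {y | t < (ϱ₁ y : ℝ)}.indicator (fun _ => (1 : ℝ≥0∞)) x
          = (Iio (ϱ₁ x : ℝ)).indicator 1 t := fun t => rfl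
      simp only [this]
      rw [lintegral_indicator_one measurableSet_Iio, Measure.restrict_apply measurableSet_Iio,
        inter_comm, Ioi_inter_Iio, Real.volume_Ioo]
      simp
    rw [h2] at h
    rw [hfac, ENNReal.coe_mul, mul_right_comm, ← h]
    refine lintegral_congr fun t => ?_
    by_cases hx : t < (ϱ₁ x : ℝ) <;> simp [indicator, hx]
  simp only [hstep]
  rw [lintegral_lintegral_swap
    (((measurable_sliceInd h₀ h₁).comp measurable_swap).mul
      ((measurable_one.indicator hA).comp measurable_fst)).aemeasurable]
  refine setLIntegral_congr_fun measurableSet_Ioi fun t ht => ?_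
  have hA1 : ∫⁻ x, {y | t < (ϱ₁ y : ℝ)}.indicator (fun y => (ϱ₀ y : ℝ≥0∞)) x * A.indicator 1 x
      = ((volume.restrict {y | t < (ϱ₁ y : ℝ)}).withDensity fun y => (ϱ₀ y : ℝ≥0∞)) A := by
    rw [withDensity_apply _ hA, Measure.restrict_restrict hA,
      ← lintegral_indicator (hA.inter (measurableSet_slice h₁ t))]
    refine lintegral_congr fun x => ?_
    by_cases hx : t < (ϱ₁ x : ℝ) <;> by_cases hxA : x ∈ A <;> simp [indicator, hx, hxA]
  simp only [hA1]
  rw [updateKernel_apply h₀ h₁, Measure.smul_apply, smul_eq_mul]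
  by_cases hz : sliceMass ϱ₀ ϱ₁ t = 0
  · have : ((volume.restrict {y | t < (ϱ₁ y : ℝ)}).withDensity fun y => (ϱ₀ y : ℝ≥0∞)) A = 0 := by
      refine measure_mono_null (subset_univ A) ?_
      rw [withDensity_apply _ MeasurableSet.univ, Measure.restrict_univ]
      exact hz
    rw [this, hz]; simp
  · rw [mul_right_comm, ENNReal.inv_mul_cancel hz (sliceMass_ne_top h₁ hint ht), one_mul]

/-- The two steps of the slice sampler are well defined from almost every point. -/
theorem ae_goodPoints {π : Measure (EuclideanSpace ℝ (Fin d))} [IsProbabilityMeasure π]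
    {ϱ : EuclideanSpace ℝ (Fin d) → ℝ≥0} (h₀ : Measurable ϱ₀) (h₁ : Measurable ϱ₁)
    (hfac : ∀ x, ϱ x = ϱ₀ x * ϱ₁ x) (hπ : HasDensity π ϱ) :
    ∀ᵐ x ∂π, sliceStep ϱ₀ ϱ₁ x univ = 1 := by
  have hle : ∀ x, sliceStep ϱ₀ ϱ₁ x univ ≤ 1 := by
    intro x
    rw [sliceStep, Kernel.comp_apply' _ _ _ MeasurableSet.univ]
    calc ∫⁻ t, updateKernel ϱ₀ ϱ₁ t univ ∂(thresholdKernel ϱ₁ x)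
        ≤ ∫⁻ _, 1 ∂(thresholdKernel ϱ₁ x) := by
          refine lintegral_mono fun t => ?_
          rw [updateKernel_apply h₀ h₁, Measure.smul_apply,
            withDensity_apply _ MeasurableSet.univ, Measure.restrict_univ, smul_eq_mul]
          exact ENNReal.inv_mul_le_one _
      _ ≤ 1 := by
          rw [lintegral_one, thresholdKernel_apply h₁, Measure.smul_apply,
            Measure.restrict_apply_univ, Real.volume_Ioo, smul_eq_mul]
          simp only [sub_zero, ENNReal.ofReal_coe_nnreal]
          exact ENNReal.inv_mul_le_one _
  have htot : ∫⁻ x, sliceStep ϱ₀ ϱ₁ x univ ∂π = ∫⁻ _, 1 ∂π := by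
    rw [← Measure.bind_apply MeasurableSet.univ (Kernel.aemeasurable _),
      sliceStep_bind h₀ h₁ hfac hπ, lintegral_one]
  exact ae_eq_of_ae_le_of_lintegral_le (ae_of_all _ hle) (by rw [htot]; simp)
    aemeasurable_const htot.ge

/-- The target is invariant under the transition kernel of the slice sampler. -/
theorem sliceKernel_invariant {π : Measure (EuclideanSpace ℝ (Fin d))} [IsProbabilityMeasure π]
    {ϱ : EuclideanSpace ℝ (Fin d) → ℝ≥0} (h₀ : Measurable ϱ₀) (h₁ : Measurable ϱ₁)
    (hfac : ∀ x, ϱ x = ϱ₀ x * ϱ₁ x) (hπ : HasDensity π ϱ) :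
    Kernel.Invariant (sliceKernel ϱ₀ ϱ₁) π := by
  classical
  rw [Kernel.Invariant]
  conv_rhs => rw [← sliceStep_bind h₀ h₁ hfac hπ]
  refine Measure.bind_congr_right ?_
  filter_upwards [ae_goodPoints h₀ h₁ hfac hπ] with x hx
  rw [sliceKernel, Kernel.piecewise_apply, if_pos (by exact hx)]

end Invariance

end SliceSampling

end

namespace SliceSampling

section Hilbert

open scoped InnerProductSpace

variable {H : Type*} [NormedAddCommGroup H] [InnerProductSpace ℝ H]

theorem inner_pow_apply_pow_apply {T : H →L[ℝ] H} (hT : ∀ x y, ⟪T x, y⟫_ℝ = ⟪x, T y⟫_ℝ)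
    (m n : ℕ) (f : H) : ⟪(T ^ m) f, (T ^ n) f⟫_ℝ = ⟪(T ^ (m + n)) f, f⟫_ℝ := by
  induction n generalizing m with
  | zero => simp
  | succ n ih =>
    rw [pow_succ' T n, mul_apply_eq_comp, ← hT, ← mul_apply_eq_comp,
      ← pow_succ', ih, Nat.succ_add_eq_add_succ]

theorem norm_pow_apply_ge {T : H →L[ℝ] H} (hT : ∀ x y, ⟪T x, y⟫_ℝ = ⟪x, T y⟫_ℝ)
    {f : H} {q : ℝ} (hf : q * ‖f‖ ≤ ‖T f‖) (n : ℕ) :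
    q * ‖(T ^ n) f‖ ≤ ‖(T ^ (n + 1)) f‖ := by
  induction n with
  | zero => simpa using hf
  | succ n ih =>
    have h : ‖(T ^ (n + 1)) f‖ ^ 2 ≤ ‖(T ^ (n + 2)) f‖ * ‖(T ^ n) f‖ := by
      rw [← real_inner_self_eq_norm_sq, inner_pow_apply_pow_apply hT,
        show n + 1 + (n + 1) = n + 2 + n by ring, ← inner_pow_apply_pow_apply hT]
      exact real_inner_le_norm _ _
    have hT0 : ∀ m, (T ^ m) f = 0 → (T ^ (m + 1)) f = 0 := fun m hm => by
      rw [pow_succ', mul_apply_eq_comp, hm, map_zero]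
    rcases (norm_nonneg ((T ^ n) f)).eq_or_lt with h0 | h0
    · rw [hT0 n (norm_eq_zero.1 h0.symm), norm_zero, mul_zero]
      exact norm_nonneg _
    · refine le_of_mul_le_mul_right ?_ h0
      nlinarith [norm_nonneg ((T ^ (n + 1)) f)]

/-- For a symmetric operator, geometric decay of the correlations of a vector controls the first
step. -/
theorem norm_apply_le_of_inner_pow_le {T : H →L[ℝ] H} (hT : ∀ x y, ⟪T x, y⟫_ℝ = ⟪x, T y⟫_ℝ)
    {f : H} {C ρ : ℝ} (hρ : 0 < ρ) (h : ∀ n, |⟪(T ^ n) f, f⟫_ℝ| ≤ C * ρ ^ n) :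
    ‖T f‖ ≤ ρ * ‖f‖ := by
  by_contra! hlt
  have hf : 0 < ‖f‖ := by
    rcases (norm_nonneg f).eq_or_lt with h0 | h0
    · rw [norm_eq_zero.1 h0.symm] at hlt
      simp at hlt
    · exact h0
  set q := ‖T f‖ / ‖f‖ with hq
  have hρq : ρ < q := by rwa [hq, lt_div_iff₀ hf]
  have hgrow : ∀ n, q ^ n * ‖f‖ ≤ ‖(T ^ n) f‖ := by
    intro n
    induction n with
    | zero => simp
    | succ n ih =>
      refine le_trans ?_ (norm_pow_apply_ge hT (q := q)
        (by rw [hq, div_mul_cancel₀ _ hf.ne']) n)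
      rw [pow_succ', mul_assoc]
      exact mul_le_mul_of_nonneg_left ih (hρ.trans hρq).le
  have hbound : ∀ n, ((q / ρ) ^ 2) ^ n * ‖f‖ ^ 2 ≤ C := by
    intro n
    have h1 : ‖(T ^ n) f‖ ^ 2 ≤ C * ρ ^ (n + n) := by
      rw [← real_inner_self_eq_norm_sq, inner_pow_apply_pow_apply hT]
      exact (le_abs_self _).trans (h _)
    have h2 : (q ^ n * ‖f‖) ^ 2 ≤ ‖(T ^ n) f‖ ^ 2 :=
      pow_le_pow_left₀ (mul_nonneg (pow_nonneg (hρ.trans hρq).le n) hf.le) (hgrow n) 2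
    have h3 : ((q / ρ) ^ 2) ^ n * ‖f‖ ^ 2 = (q ^ n * ‖f‖) ^ 2 / ρ ^ (n + n) := by
      rw [div_pow, div_pow]
      ring
    rw [h3, div_le_iff₀ (by positivity)]
    exact h2.trans h1
  have hone : 1 < (q / ρ) ^ 2 := one_lt_pow₀ ((one_lt_div hρ).2 hρq) two_ne_zero
  obtain ⟨n, hn⟩ := pow_unbounded_of_one_lt (C / ‖f‖ ^ 2) hone
  rw [div_lt_iff₀ (by positivity)] at hn
  exact absurd (hbound n) hn.not_ge

/-- A criterion for a gap between the eigenvalue `1` of a symmetric operator and the rest of its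
spectrum. -/
theorem norm_apply_sub_le_of_closure {T : H →L[ℝ] H} (hT : ∀ x y, ⟪T x, y⟫_ℝ = ⟪x, T y⟫_ℝ)
    {e : H} (he : ‖e‖ = 1) (hTe : T e = e) {ρ : ℝ} (hρ : 0 < ρ) {D : Set H}
    (hD : ∀ f ∈ D, ∃ C : ℝ, ∀ n : ℕ, |⟪(T ^ n) f, f⟫_ℝ - ⟪e, f⟫_ℝ ^ 2| ≤ C * ρ ^ n)
    (hcl : ∀ g, T g ∈ closure D) (g : H) : ‖T g - ⟪e, g⟫_ℝ • e‖ ≤ ρ * ‖g‖ := by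
  have hee : ⟪e, e⟫_ℝ = 1 := by rw [real_inner_self_eq_norm_sq, he, one_pow]
  have hpow : ∀ n : ℕ, (T ^ n) e = e := by
    intro n
    induction n with
    | zero => simp
    | succ n ih => rw [pow_succ', mul_apply_eq_comp, ih, hTe]
  have heT : ∀ f, ⟪e, T f⟫_ℝ = ⟪e, f⟫_ℝ := fun f => by rw [← hT, hTe]
  have hepow : ∀ (n : ℕ) f, ⟪e, (T ^ n) f⟫_ℝ = ⟪e, f⟫_ℝ := by
    intro n f
    induction n with
    | zero => simp
    | succ n ih => rw [pow_succ', mul_apply_eq_comp, heT, ih]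
  set c : H → H := fun f => f - ⟪e, f⟫_ℝ • e with hc
  have hcont : Continuous c := by fun_prop
  have hDle : ∀ f ∈ D, ‖T (c f)‖ ≤ ρ * ‖c f‖ := by
    intro f hf
    obtain ⟨C, hC⟩ := hD f hf
    refine norm_apply_le_of_inner_pow_le hT hρ (C := C) fun n => ?_
    convert hC n using 2
    simp only [hc, map_sub, map_smul, hpow, inner_sub_left, inner_sub_right, inner_smul_left,
      inner_smul_right, hee, real_inner_comm e ((T ^ n) f), hepow, RCLike.conj_to_real]
    ring
  have hclosed : ∀ f ∈ closure D, ‖T (c f)‖ ≤ ρ * ‖c f‖ := fun f hf =>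
    closure_minimal (t := {f | ‖T (c f)‖ ≤ ρ * ‖c f‖}) hDle
      (isClosed_le (by fun_prop) (by fun_prop)) hf
  have hTc : ∀ f, T (c f) = c (T f) := fun f => by simp [hc, hTe, heT]
  have hnorm : ‖c g‖ ≤ ‖g‖ := by
    have : ‖c g‖ ^ 2 = ‖g‖ ^ 2 - ⟪e, g⟫_ℝ ^ 2 := by
      simp only [hc, norm_sub_sq_real, norm_smul, he, inner_smul_right, real_inner_comm e g,
        Real.norm_eq_abs, mul_one, sq_abs]
      ring
    exact (sq_le_sq₀ (norm_nonneg _) (norm_nonneg _)).1 (by nlinarith [sq_nonneg ⟪e, g⟫_ℝ])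
  change ‖T g - ⟪e, g⟫_ℝ • e‖ ≤ ρ * ‖g‖
  have hTg : T g - ⟪e, g⟫_ℝ • e = T (c g) := by rw [hTc]; simp [hc, heT]
  rw [hTg]
  have h1 : ‖T (c g)‖ ^ 2 ≤ ρ * ‖T (c g)‖ * ‖c g‖ := by
    rw [← real_inner_self_eq_norm_sq, ← hT (T (c g))]
    refine (real_inner_le_norm _ _).trans ?_
    gcongr
    rw [hTc]
    exact hclosed _ (hcl g)
  rcases (norm_nonneg (T (c g))).eq_or_lt with h0 | h0
  · rw [← h0]
    positivity
  · have h2 : ‖T (c g)‖ ≤ ρ * ‖c g‖ := le_of_mul_le_mul_right (by nlinarith) h0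
    exact h2.trans (by gcongr)

end Hilbert

section MarkovOperator

variable {G : Type*} [MeasurableSpace G] {ν : Measure G} {P : Kernel G G} [IsMarkovKernel P]

theorem memLp_integral_kernel [SFinite ν] (hP : Kernel.Invariant P ν) {g : G → ℝ}
    (hg : MemLp g 2 ν) :
    MemLp (fun x => ∫ y, g y ∂(P x)) 2 ν ∧
      eLpNorm (fun x => ∫ y, g y ∂(P x)) 2 ν ≤ eLpNorm g 2 ν := by
  have hgm : AEStronglyMeasurable g (P ∘ₘ ν) := by rw [hP.def]; exact hg.1
  have hae : ∀ᵐ x ∂ν, g =ᵐ[P x] hgm.mk g := Measure.ae_ae_of_ae_comp hgm.ae_eq_mk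
  have hmeas : AEStronglyMeasurable (fun x => ∫ y, g y ∂(P x)) ν := by
    refine ⟨fun x => ∫ y, hgm.mk g y ∂(P x), hgm.stronglyMeasurable_mk.integral_kernel, ?_⟩
    filter_upwards [hae] with x hx using integral_congr_ae hx
  have hle : eLpNorm (fun x => ∫ y, g y ∂(P x)) 2 ν ≤ eLpNorm g 2 ν := by
    rw [eLpNorm_eq_lintegral_rpow_enorm_toReal two_ne_zero ENNReal.ofNat_ne_top,
      eLpNorm_eq_lintegral_rpow_enorm_toReal two_ne_zero ENNReal.ofNat_ne_top]
    refine ENNReal.rpow_le_rpow ?_ (by simp)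
    have hbind : ∫⁻ x, ‖g x‖ₑ ^ (2 : ℝ≥0∞).toReal ∂ν
        = ∫⁻ x, ∫⁻ y, ‖g y‖ₑ ^ (2 : ℝ≥0∞).toReal ∂(P x) ∂ν := by
      conv_lhs => rw [← hP.def]
      exact Measure.lintegral_bind (Kernel.aemeasurable _) (hgm.enorm.pow_const _)
    rw [hbind]
    refine lintegral_mono_ae ?_
    filter_upwards [hae] with x hx
    have hx' : AEStronglyMeasurable g (P x) := ⟨_, hgm.stronglyMeasurable_mk, hx⟩
    have h1 : ‖∫ y, g y ∂(P x)‖ₑ ≤ eLpNorm g 2 (P x) := by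
      refine (enorm_integral_le_lintegral_enorm _).trans ?_
      rw [← eLpNorm_one_eq_lintegral_enorm]
      exact eLpNorm_le_eLpNorm_of_exponent_le one_le_two hx'
    refine (ENNReal.rpow_le_rpow h1 (by simp)).trans ?_
    rw [eLpNorm_eq_lintegral_rpow_enorm_toReal two_ne_zero ENNReal.ofNat_ne_top,
      ← ENNReal.rpow_mul]
    simp
  exact ⟨⟨hmeas, hle.trans_lt hg.2⟩, hle⟩

/-- A Markov kernel acts on the `L₂` space of an invariant probability measure. -/
theorem exists_markovOperator [IsProbabilityMeasure ν] (hP : Kernel.Invariant P ν) :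
    ∃ T : Lp ℝ 2 ν →L[ℝ] Lp ℝ 2 ν, ∀ g : Lp ℝ 2 ν, T g =ᵐ[ν] fun x => ∫ y, g y ∂(P x) := by
  have hint : ∀ g : Lp ℝ 2 ν, ∀ᵐ x ∂ν, Integrable g (P x) := fun g =>
    Measure.ae_integrable_of_integrable_comp
      (by rw [hP.def]; exact (Lp.memLp g).integrable one_le_two)
  let A : Lp ℝ 2 ν → Lp ℝ 2 ν := fun g => (memLp_integral_kernel hP (Lp.memLp g)).1.toLp _
  have hA : ∀ g, A g =ᵐ[ν] fun x => ∫ y, g y ∂(P x) := fun g => MemLp.coeFn_toLp _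
  have hae : ∀ {f g : G → ℝ}, f =ᵐ[ν] g → ∀ᵐ x ∂ν, f =ᵐ[P x] g := fun {f g} h =>
    Measure.ae_ae_of_ae_comp (by rwa [hP.def])
  let B : Lp ℝ 2 ν →ₗ[ℝ] Lp ℝ 2 ν :=
    { toFun := A
      map_add' := fun f g => by
        apply Lp.ext
        filter_upwards [hA (f + g), hA f, hA g, Lp.coeFn_add (A f) (A g), hae (Lp.coeFn_add f g),
          hint f, hint g] with x h1 h2 h3 h4 h5 h6 h7
        rw [h1, h4, Pi.add_apply, h2, h3, integral_congr_ae h5, ← integral_add h6 h7]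
        rfl
      map_smul' := fun a g => by
        apply Lp.ext
        filter_upwards [hA (a • g), hA g, Lp.coeFn_smul a (A g), hae (Lp.coeFn_smul a g)]
          with x h1 h2 h3 h4
        rw [h1, RingHom.id_apply, h3, Pi.smul_apply, h2, integral_congr_ae h4, smul_eq_mul,
          ← integral_const_mul]
        rfl }
  refine ⟨B.mkContinuous 1 fun g => ?_, hA⟩
  rw [one_mul]
  change ‖(memLp_integral_kernel hP (Lp.memLp g)).1.toLp _‖ ≤ ‖g‖
  rw [Lp.norm_toLp, Lp.norm_def]
  exact ENNReal.toReal_mono (Lp.memLp g).2.ne (memLp_integral_kernel hP (Lp.memLp g)).2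

theorem integral_mul_integral_kernel_comm [IsProbabilityMeasure ν] (hP : P.IsReversible ν)
    {f g : G → ℝ} (hf : MemLp f 2 ν) (hg : MemLp g 2 ν) :
    ∫ x, f x * ∫ y, g y ∂(P x) ∂ν = ∫ x, (∫ y, f y ∂(P x)) * g x ∂ν := by
  have hswap : (ν ⊗ₘ P).map Prod.swap = ν ⊗ₘ P := by
    refine Measure.ext_prod fun {s t} hs ht => ?_
    rw [Measure.map_apply measurable_swap (hs.prod ht), preimage_swap_prod,
      Measure.compProd_apply_prod ht hs, Measure.compProd_apply_prod hs ht]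
    exact hP ht hs
  have hfst : (ν ⊗ₘ P).map Prod.fst = ν := Measure.fst_compProd ν P
  have hsnd : (ν ⊗ₘ P).map Prod.snd = ν := by
    rw [← Measure.snd, Measure.snd_compProd, hP.invariant.def]
  have hL1 : ∀ {f : G → ℝ}, MemLp f 2 ν → MemLp (fun p : G × G => f p.1) 2 (ν ⊗ₘ P) := fun h =>
    MemLp.comp_of_map (by rwa [hfst]) measurable_fst.aemeasurable
  have hL2 : ∀ {f : G → ℝ}, MemLp f 2 ν → MemLp (fun p : G × G => f p.2) 2 (ν ⊗ₘ P) := fun h =>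
    MemLp.comp_of_map (by rwa [hsnd]) measurable_snd.aemeasurable
  have hfg : Integrable (fun p : G × G => f p.1 * g p.2) (ν ⊗ₘ P) :=
    (hL1 hf).integrable_mul (hL2 hg)
  have hgf : Integrable (fun p : G × G => f p.2 * g p.1) (ν ⊗ₘ P) :=
    (hL2 hf).integrable_mul (hL1 hg)
  calc ∫ x, f x * ∫ y, g y ∂(P x) ∂ν = ∫ p, f p.1 * g p.2 ∂(ν ⊗ₘ P) := by
        rw [Measure.integral_compProd hfg]
        simp only [integral_const_mul]
    _ = ∫ p, f p.2 * g p.1 ∂(ν ⊗ₘ P) := by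
        rw [← hswap, integral_map measurable_swap.aemeasurable (by rw [hswap]; exact hfg.1), hswap]
        rfl
    _ = ∫ x, (∫ y, f y ∂(P x)) * g x ∂ν := by
        rw [Measure.integral_compProd hgf]
        simp only [integral_mul_const]

/-- A reversible Markov kernel whose correlations decay geometrically on a class of
square-integrable functions that approximates its range contracts mean-zero functions. -/
theorem deviationNorm_le [IsProbabilityMeasure ν] (hP : P.IsReversible ν) {ρ : ℝ} (hρ : 0 < ρ)
    {D : Set (G → ℝ)} (hmem : ∀ f ∈ D, MemLp f 2 ν)
    (hdecay : ∀ f ∈ D, ∃ C : ℝ, ∀ n : ℕ,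
      |∫ x, ((fun h x => ∫ y, h y ∂(P x))^[n] f) x * f x ∂ν - (∫ x, f x ∂ν) ^ 2| ≤ C * ρ ^ n)
    (hdense : ∀ g, MemLp g 2 ν → ∀ ε : ℝ, 0 < ε →
      ∃ f ∈ D, eLpNorm (f - fun x => ∫ y, g y ∂(P x)) 2 ν ≤ ENNReal.ofReal ε) :
    deviationNorm ν P ≤ ENNReal.ofReal ρ := by
  obtain ⟨T, hT⟩ := exists_markovOperator hP.invariant
  have hone : MemLp (fun _ : G => (1 : ℝ)) 2 ν := memLp_const 1
  have hTtoLp : ∀ {f : G → ℝ} (hf : MemLp f 2 ν),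
      T (hf.toLp f) = (memLp_integral_kernel hP.invariant hf).1.toLp _ := by
    intro f hf
    apply Lp.ext
    filter_upwards [hT (hf.toLp f), MemLp.coeFn_toLp (memLp_integral_kernel hP.invariant hf).1,
      Measure.ae_ae_of_ae_comp (κ := P) (μ := ν) (p := fun y => hf.toLp f y = f y)
        (by rw [hP.invariant.def]; exact hf.coeFn_toLp)] with x h1 h2 h3
    rw [h1, h2, integral_congr_ae h3]
  have hinner : ∀ {f g : G → ℝ} (hf : MemLp f 2 ν) (hg : MemLp g 2 ν),
      inner ℝ (hf.toLp f) (hg.toLp g) = ∫ x, f x * g x ∂ν := by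
    intro f g hf hg
    rw [L2.inner_def]
    refine integral_congr_ae ?_
    filter_upwards [hf.coeFn_toLp, hg.coeFn_toLp] with x h1 h2
    rw [h1, h2]
    simp [mul_comm]
  set e : Lp ℝ 2 ν := hone.toLp _ with he
  have hiter : ∀ {f : G → ℝ} (hf : MemLp f 2 ν) (n : ℕ),
      ∃ hn : MemLp ((fun h x => ∫ y, h y ∂(P x))^[n] f) 2 ν, (T ^ n) (hf.toLp f) = hn.toLp _ := by
    intro f hf n
    induction n with
    | zero => exact ⟨hf, rfl⟩
    | succ n ih =>
      obtain ⟨hn, h⟩ := ih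
      rw [pow_succ', mul_apply_eq_comp, h, hTtoLp]
      simp only [Function.iterate_succ_apply']
      exact ⟨(memLp_integral_kernel hP.invariant hn).1, trivial⟩
  have hsymm : ∀ x y, inner ℝ (T x) y = inner ℝ x (T y) := by
    intro f g
    rw [← Lp.toLp_coeFn f (Lp.memLp f), ← Lp.toLp_coeFn g (Lp.memLp g), hTtoLp, hTtoLp, hinner,
      hinner, integral_mul_integral_kernel_comm hP (Lp.memLp f) (Lp.memLp g)]
  have henorm : ‖e‖ = 1 := by
    rw [← pow_left_inj₀ (norm_nonneg _) zero_le_one two_ne_zero, ← real_inner_self_eq_norm_sq, he,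
      hinner]
    simp
  have hTe : T e = e := by
    rw [he, hTtoLp]
    congr 1
    simp
  refine iSup_le fun g => iSup_le fun hg => iSup_le fun hg1 => ?_
  have key := norm_apply_sub_le_of_closure hsymm henorm hTe hρ
    (D := {F | ∃ f ∈ D, ∃ hf : MemLp f 2 ν, F = hf.toLp f}) ?_ ?_ (hg.toLp g)
  · rw [hTtoLp, he, hinner, ← MemLp.toLp_const_smul, ← MemLp.toLp_sub, Lp.norm_toLp,
      Lp.norm_toLp] at key
    have h1 : (eLpNorm g 2 ν).toReal ≤ 1 := by simpa using ENNReal.toReal_mono (by simp) hg1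
    have h2 := key.trans (mul_le_of_le_one_right hρ.le h1)
    rw [← ENNReal.ofReal_le_ofReal_iff hρ.le, ENNReal.ofReal_toReal] at h2
    · refine le_of_eq_of_le (congrArg (eLpNorm · 2 ν) (funext fun x => ?_)) h2
      simp
    · exact ((memLp_integral_kernel hP.invariant hg).1.sub (hone.const_smul _)).2.ne
  · rintro F ⟨f, hfD, hf, rfl⟩
    obtain ⟨C, hC⟩ := hdecay f hfD
    refine ⟨C, fun n => ?_⟩
    obtain ⟨hn, h⟩ := hiter hf n
    rw [h, he, hinner, hinner]
    simpa using hC n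
  · intro F
    rw [Metric.mem_closure_iff]
    intro ε hε
    obtain ⟨f, hfD, hf⟩ := hdense F (Lp.memLp F) (ε / 2) (half_pos hε)
    refine ⟨(hmem f hfD).toLp f, ⟨f, hfD, hmem f hfD, rfl⟩, ?_⟩
    rw [← Lp.toLp_coeFn F (Lp.memLp F), hTtoLp, dist_comm, dist_eq_norm, ← MemLp.toLp_sub,
      Lp.norm_toLp]
    exact (ENNReal.toReal_le_of_le_ofReal (half_pos hε).le hf).trans_lt (half_lt_self hε)

end MarkovOperator

section LevelFunction

/-- The coordinate `r = ℓ(t) ^ (1 / k)`, in which the slice sampler contracts. -/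
noncomputable def levelRadius (k : ℝ) (ℓ : ℝ → ℝ) (t : ℝ) : ℝ := ℓ t ^ (1 / k)

/-- The points `t > 0` at which `ℓ` is positive. -/
def positiveLevels (ℓ : ℝ → ℝ) : Set ℝ := {t | 0 < t ∧ 0 < ℓ t}

variable {k : ℝ} {ℓ : ℝ → ℝ}

namespace MemLambda

theorem positiveLevels_subset (h : MemLambda k ℓ) : positiveLevels ℓ ⊆ levelSupp ℓ := by
  rintro t ⟨ht, hpos⟩
  have hc : ContinuousAt ℓ t := h.continuousOn.continuousAt (Ioi_mem_nhds ht)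
  obtain ⟨s, hs, hts⟩ := (((hc.eventually (lt_mem_nhds hpos)).filter_mono
    (nhdsWithin_le_nhds (s := Ioi t))).and self_mem_nhdsWithin).exists
  have hs0 : 0 < s := ht.trans hts
  refine ⟨ht, lt_of_lt_of_le ?_ (le_iSup₂ (f := fun (s : ℝ) (_ : s ∈ {s : ℝ | 0 < s ∧ 0 < ℓ s}) =>
    ENNReal.ofReal s) s ⟨hs0, hs⟩)⟩
  exact (ENNReal.ofReal_lt_ofReal_iff hs0).2 hts

theorem apply_lt (h : MemLambda k ℓ) {s t : ℝ} (hs : s ∈ positiveLevels ℓ) (hst : s < t) :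
    ℓ t < ℓ s := by
  by_cases ht : 0 < ℓ t
  · exact h.strictAntiOn (h.positiveLevels_subset hs)
      (h.positiveLevels_subset ⟨hs.1.trans hst, ht⟩) hst
  · exact (not_lt.1 ht).trans_lt hs.2

theorem antitoneOn (h : MemLambda k ℓ) : AntitoneOn ℓ (Ioi 0) := by
  intro s hs t ht hst
  rcases hst.eq_or_lt with rfl | hst
  · exact le_rfl
  by_cases hpos : 0 < ℓ t
  · have ht' := h.positiveLevels_subset ⟨ht, hpos⟩
    have hs' : s ∈ levelSupp ℓ :=
      ⟨hs, (ENNReal.ofReal_le_ofReal hst.le).trans_lt ht'.2⟩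
    exact (h.strictAntiOn hs' ht' hst).le
  · exact (not_lt.1 hpos).trans (h.nonneg s hs)

theorem mem_positiveLevels_of_le (h : MemLambda k ℓ) {s t : ℝ} (ht : t ∈ positiveLevels ℓ)
    (hs : 0 < s) (hst : s ≤ t) : s ∈ positiveLevels ℓ :=
  ⟨hs, ht.2.trans_le (h.antitoneOn hs ht.1 hst)⟩

theorem levelInv_apply (h : MemLambda k ℓ) {t : ℝ} (ht : t ∈ positiveLevels ℓ) :
    levelInv ℓ (ℓ t) = t :=
  h.strictAntiOn.injOn.leftInvOn_invFunOn (h.positiveLevels_subset ht)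

theorem exists_apply_eq (h : MemLambda k ℓ) {t c : ℝ} (ht : 0 < t) (hc : 0 < c) (hct : c ≤ ℓ t) :
    ∃ s, t ≤ s ∧ ℓ s = c := by
  obtain ⟨T, hT, htT⟩ := ((h.tendsto_atTop.eventually (gt_mem_nhds hc)).and
    (eventually_ge_atTop t)).exists
  obtain ⟨s, hs, rfl⟩ := intermediate_value_Icc' htT
    (h.continuousOn.mono fun s hs => ht.trans_le hs.1) ⟨hT.le, hct⟩
  exact ⟨s, hs.1, rfl⟩

theorem levelRadius_nonneg (h : MemLambda k ℓ) {t : ℝ} (ht : 0 < t) : 0 ≤ levelRadius k ℓ t :=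
  Real.rpow_nonneg (h.nonneg t ht) _

theorem levelRadius_pos {t : ℝ} (ht : t ∈ positiveLevels ℓ) : 0 < levelRadius k ℓ t :=
  Real.rpow_pos_of_pos ht.2 _

theorem levelRadius_antitoneOn (h : MemLambda k ℓ) (hk : 0 < k) :
    AntitoneOn (levelRadius k ℓ) (Ioi 0) := fun _ hs t ht hst =>
  Real.rpow_le_rpow (h.nonneg t ht) (h.antitoneOn hs ht hst) (by positivity)

theorem levelRadius_lt (h : MemLambda k ℓ) (hk : 0 < k) {s t : ℝ} (hs : s ∈ positiveLevels ℓ)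
    (hst : s < t) : levelRadius k ℓ t < levelRadius k ℓ s :=
  Real.rpow_lt_rpow (h.nonneg t (hs.1.trans hst)) (h.apply_lt hs hst) (by positivity)

theorem levelInv_levelRadius_rpow (h : MemLambda k ℓ) (hk : 0 < k) {t : ℝ}
    (ht : t ∈ positiveLevels ℓ) : levelInv ℓ (levelRadius k ℓ t ^ k) = t := by
  rw [levelRadius, one_div, Real.rpow_inv_rpow ht.2.le hk.ne', h.levelInv_apply ht]

theorem exists_concaveOn (h : MemLambda k ℓ) (hk : 0 < k) :
    ∃ D : Set ℝ, (∀ t ∈ positiveLevels ℓ, levelRadius k ℓ t ∈ D) ∧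
      ConcaveOn ℝ D fun r => Real.log (levelInv ℓ (r ^ k)) := by
  obtain ⟨S, -, hS, hconc⟩ := h.logConcave
  refine ⟨_, fun t ht => ?_, hconc⟩
  refine ⟨levelRadius_pos ht, ?_⟩
  have ht2 : t / 2 ∈ positiveLevels ℓ :=
    h.mem_positiveLevels_of_le ht (half_pos ht.1) (half_le_self ht.1.le)
  have hle : ENNReal.ofReal (ℓ (t / 2)) ≤ S := by
    refine ge_of_tendsto hS ?_
    filter_upwards [Ioo_mem_nhdsGT ht2.1] with s hs
    exact ENNReal.ofReal_le_ofReal (h.antitoneOn hs.1 ht2.1 hs.2.le)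
  rw [levelRadius, ← ENNReal.ofReal_rpow_of_pos ht.2]
  refine ENNReal.rpow_lt_rpow (lt_of_lt_of_le ?_ hle) (by positivity)
  exact (ENNReal.ofReal_lt_ofReal_iff ht2.2).2 (h.apply_lt ht2 (half_lt_self ht.1))

theorem sub_le_sub_of_concaveOn {D : Set ℝ} {φ : ℝ → ℝ} (hφ : ConcaveOn ℝ D φ) {a b c d : ℝ}
    (ha : a ∈ D) (hd : d ∈ D) (hab : a < b) (hac : a < c) (hbd : b < d) (hcd : c < d)
    (hlt : φ d < φ c) (heq : φ a - φ b = φ c - φ d) : d - c ≤ b - a := by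
  have h1 := hφ.neg.secant_mono_aux1 ha hd hab hbd
  have h2 := hφ.neg.secant_mono_aux1 ha hd hac hcd
  simp only [Pi.neg_apply] at h1 h2
  have hN : 0 < φ a - φ d := by
    by_contra! hN
    nlinarith
  refine le_of_mul_le_mul_right ?_ hN
  nlinarith

/-- Log-concavity says that multiplying the threshold by a constant does not increase distances in
the radial coordinate. -/
theorem levelRadius_mul_sub_le (h : MemLambda k ℓ) (hk : 0 < k) {s t v : ℝ} (hs : 0 < s)
    (hst : s ≤ t) (ht : t ∈ positiveLevels ℓ) (hv : 0 < v) (hv1 : v ≤ 1) :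
    levelRadius k ℓ (v * s) - levelRadius k ℓ (v * t) ≤ levelRadius k ℓ s - levelRadius k ℓ t := by
  rcases hst.eq_or_lt with rfl | hst
  · simp
  rcases hv1.eq_or_lt with rfl | hv1
  · simp
  obtain ⟨D, hD, hconc⟩ := h.exists_concaveOn hk
  have hsI := h.mem_positiveLevels_of_le ht hs hst.le
  have hvt : v * t < t := mul_lt_of_lt_one_left ht.1 hv1
  have hvs : v * s < s := mul_lt_of_lt_one_left hs hv1
  have hvst : v * s < v * t := mul_lt_mul_of_pos_left hst hv
  have hvtI := h.mem_positiveLevels_of_le ht (mul_pos hv ht.1) hvt.le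
  have hvsI := h.mem_positiveLevels_of_le hsI (mul_pos hv hs) hvs.le
  refine sub_le_sub_of_concaveOn hconc (hD t ht) (hD _ hvsI) (h.levelRadius_lt hk hsI hst)
    (h.levelRadius_lt hk hvtI hvt) (h.levelRadius_lt hk hvsI hvs) (h.levelRadius_lt hk hvsI hvst)
    ?_ ?_
  · simp only [h.levelInv_levelRadius_rpow hk hvtI, h.levelInv_levelRadius_rpow hk hvsI]
    exact Real.log_lt_log hvsI.1 hvst
  · simp only [h.levelInv_levelRadius_rpow hk hvtI, h.levelInv_levelRadius_rpow hk hvsI,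
      h.levelInv_levelRadius_rpow hk hsI, h.levelInv_levelRadius_rpow hk ht]
    rw [Real.log_mul hv.ne' ht.1.ne', Real.log_mul hv.ne' hs.ne']
    ring

theorem abs_levelRadius_mul_sub_le (h : MemLambda k ℓ) (hk : 0 < k) {s t v : ℝ}
    (hs : s ∈ positiveLevels ℓ) (ht : t ∈ positiveLevels ℓ) (hv : 0 < v) (hv1 : v ≤ 1) :
    |levelRadius k ℓ (v * s) - levelRadius k ℓ (v * t)|
      ≤ |levelRadius k ℓ s - levelRadius k ℓ t| := by
  wlog hst : s ≤ t generalizing s t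
  · rw [abs_sub_comm, abs_sub_comm (levelRadius k ℓ s)]
    exact this ht hs (not_le.1 hst).le
  rw [abs_of_nonneg (sub_nonneg.2 (h.levelRadius_antitoneOn hk (mul_pos hv hs.1) (mul_pos hv ht.1)
    (mul_le_mul_of_nonneg_left hst hv.le)))]
  exact (h.levelRadius_mul_sub_le hk hs.1 hst ht hv hv1).trans (le_abs_self _)

/-- The radial coordinate grows at most logarithmically at small thresholds. -/
theorem exists_levelRadius_le_log (h : MemLambda k ℓ) (hk : 0 < k)
    (hne : (positiveLevels ℓ).Nonempty) :
    ∃ T > 0, ∃ A B : ℝ, 0 ≤ A ∧ 0 ≤ B ∧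
      ∀ t, 0 < t → t < T → levelRadius k ℓ t ≤ A + B * Real.log (T / t) := by
  obtain ⟨D, hD, hconc⟩ := h.exists_concaveOn hk
  obtain ⟨t₀, h₀⟩ := hne
  have h₁ := h.mem_positiveLevels_of_le h₀ (half_pos h₀.1) (half_le_self h₀.1.le)
  set t₁ := t₀ / 2 with ht₁
  have h01 : t₁ < t₀ := half_lt_self h₀.1
  have hr := h.levelRadius_lt hk h₁ h01
  have hlog : 0 < Real.log t₀ - Real.log t₁ := sub_pos.2 (Real.log_lt_log h₁.1 h01)
  refine ⟨t₁, h₁.1, levelRadius k ℓ t₁,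
    (levelRadius k ℓ t₁ - levelRadius k ℓ t₀) / (Real.log t₀ - Real.log t₁),
    (levelRadius_pos h₁).le, div_nonneg (sub_nonneg.2 hr.le) hlog.le, fun t ht htt => ?_⟩
  have htI := h.mem_positiveLevels_of_le h₁ ht htt.le
  have key := hconc.neg.secant_mono_aux1 (hD _ h₀) (hD _ htI) hr (h.levelRadius_lt hk htI htt)
  simp only [Pi.neg_apply, h.levelInv_levelRadius_rpow hk h₁, h.levelInv_levelRadius_rpow hk h₀,
    h.levelInv_levelRadius_rpow hk htI] at key
  rw [Real.log_div h₁.1.ne' ht.ne', ← sub_le_iff_le_add', div_mul_eq_mul_div, le_div_iff₀ hlog]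
  linarith

theorem lintegral_levelRadius_mul_ne_top (h : MemLambda k ℓ) (hk : 0 < k)
    (hint : ∫⁻ t in Ioi (0 : ℝ), ENNReal.ofReal (ℓ t) ≠ ∞) :
    ∫⁻ t in Ioi (0 : ℝ), ENNReal.ofReal (levelRadius k ℓ t) * ENNReal.ofReal (ℓ t) ≠ ∞ := by
  by_cases hne : (positiveLevels ℓ).Nonempty
  swap
  · have h0 : ∫⁻ t in Ioi (0 : ℝ), ENNReal.ofReal (levelRadius k ℓ t) * ENNReal.ofReal (ℓ t)
        = ∫⁻ _ in Ioi (0 : ℝ), 0 := by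
      refine setLIntegral_congr_fun measurableSet_Ioi fun t ht => ?_
      have : ℓ t ≤ 0 := not_lt.1 fun hpos => hne ⟨t, ht, hpos⟩
      simp [ENNReal.ofReal_of_nonpos this]
    rw [h0]
    simp
  obtain ⟨T, hT, A, B, hA, hB, hle⟩ := h.exists_levelRadius_le_log hk hne
  rw [← Ioo_union_Ici_eq_Ioi hT, ← lt_top_iff_ne_top]
  refine (lintegral_union_le _ _ _).trans_lt (ENNReal.add_lt_top.2 ⟨?_, ?_⟩)
  · set ε : ℝ := 1 / (2 * (k + 1)) with hε
    have hε0 : 0 < ε := by positivity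
    set c : ℝ := A + B / ε with hc
    have hbound : ∀ t ∈ Ioo 0 T, ENNReal.ofReal (levelRadius k ℓ t) * ENNReal.ofReal (ℓ t)
        ≤ ENNReal.ofReal (c ^ (k + 1) * T ^ (1 / 2 : ℝ) * t ^ (-(1 / 2) : ℝ)) := by
      intro t ht
      have hr0 := h.levelRadius_nonneg (k := k) ht.1
      have hTt : 1 ≤ T / t := (one_le_div ht.1).2 ht.2.le
      have h1 : levelRadius k ℓ t ≤ c * (T / t) ^ ε := by
        refine (hle t ht.1 ht.2).trans ?_
        have h2 := Real.log_le_rpow_div (zero_le_one.trans hTt) hε0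
        have h3 : 1 ≤ (T / t) ^ ε := Real.one_le_rpow hTt hε0.le
        calc A + B * Real.log (T / t) ≤ A * (T / t) ^ ε + B * ((T / t) ^ ε / ε) := by
              gcongr
              exact le_mul_of_one_le_right hA h3
          _ = c * (T / t) ^ ε := by rw [hc]; ring
      have hℓr : ℓ t = levelRadius k ℓ t ^ k := by
        rw [levelRadius, one_div, Real.rpow_inv_rpow (h.nonneg t ht.1) hk.ne']
      rw [← ENNReal.ofReal_mul hr0]
      refine ENNReal.ofReal_le_ofReal ?_
      calc levelRadius k ℓ t * ℓ t = levelRadius k ℓ t ^ (k + 1) := by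
            rw [hℓr, Real.rpow_add_one' hr0 (by positivity), mul_comm]
        _ ≤ (c * (T / t) ^ ε) ^ (k + 1) := Real.rpow_le_rpow hr0 h1 (by positivity)
        _ = c ^ (k + 1) * T ^ (1 / 2 : ℝ) * t ^ (-(1 / 2) : ℝ) := by
            have hTt0 : 0 ≤ T / t := zero_le_one.trans hTt
            rw [Real.mul_rpow (by positivity) (by positivity), ← Real.rpow_mul hTt0,
              show ε * (k + 1) = 1 / 2 by rw [hε]; field_simp, Real.div_rpow hT.le ht.1.le,
              Real.rpow_neg ht.1.le]
            ring
    refine (setLIntegral_mono' measurableSet_Ioo hbound).trans_lt ?_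
    exact (((intervalIntegral.integrableOn_Ioo_rpow_iff hT).2 (by norm_num)).const_mul
      _).lintegral_lt_top
  · have hbound : ∀ t ∈ Ici T, ENNReal.ofReal (levelRadius k ℓ t) * ENNReal.ofReal (ℓ t)
        ≤ ENNReal.ofReal (levelRadius k ℓ T) * ENNReal.ofReal (ℓ t) := fun t ht => by
      gcongr
      exact h.levelRadius_antitoneOn hk hT (hT.trans_le ht) ht
    refine (setLIntegral_mono' measurableSet_Ici hbound).trans_lt ?_
    rw [lintegral_const_mul' _ _ ENNReal.ofReal_ne_top]
    refine ENNReal.mul_lt_top ENNReal.ofReal_lt_top (lt_of_le_of_lt ?_ hint.lt_top)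
    exact lintegral_mono_set fun t ht => hT.trans_le ht

end MemLambda

section Distribution

variable {X : Type*} [MeasurableSpace X] {m : Measure X} {S : X → ℝ}

/-- If `ℓ t` is the mass of `{t < S}`, then on this set `ℓ ∘ S` is uniformly distributed. -/
theorem MemLambda.map_restrict_eq (h : MemLambda k ℓ) (hℓm : Measurable ℓ) (hS : Measurable S)
    (hm : ∀ t, 0 < t → m {x | t < S x} = ENNReal.ofReal (ℓ t)) {t : ℝ} (ht : 0 < t) :
    (m.restrict {x | t < S x}).map (fun x => ℓ (S x)) = volume.restrict (Ioc 0 (ℓ t)) := by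
  have hset : ∀ s, MeasurableSet {x | s < S x} := fun s => measurableSet_lt measurable_const hS
  have hfin : IsFiniteMeasure (m.restrict {x | t < S x}) :=
    ⟨by rw [Measure.restrict_apply_univ, hm t ht]; exact ENNReal.ofReal_lt_top⟩
  have hcomp : Measurable fun x => ℓ (S x) := hℓm.comp hS
  refine Measure.ext_of_Ici _ _ fun a => ?_
  rw [Measure.map_apply hcomp measurableSet_Ici,
    Measure.restrict_apply (hcomp measurableSet_Ici),
    Measure.restrict_apply measurableSet_Ici]
  rcases le_or_gt a 0 with ha | ha
  · have h1 : (fun x => ℓ (S x)) ⁻¹' Ici a ∩ {x | t < S x} = {x | t < S x} :=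
      inter_eq_right.2 fun x hx => ha.trans (h.nonneg _ (ht.trans hx))
    have h2 : Ici a ∩ Ioc 0 (ℓ t) = Ioc 0 (ℓ t) := inter_eq_right.2 fun w hw => ha.trans hw.1.le
    rw [h1, h2, hm t ht, Real.volume_Ioc, sub_zero]
  have h2 : Ici a ∩ Ioc 0 (ℓ t) = Icc a (ℓ t) := by
    ext w
    exact ⟨fun hw => ⟨hw.1, hw.2.2⟩, fun hw => ⟨hw.1, ha.trans_le hw.1, hw.2⟩⟩
  rw [h2, Real.volume_Icc]
  rcases le_or_gt a (ℓ t) with hat | hat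
  · obtain ⟨s, hts, rfl⟩ := h.exists_apply_eq ht ha hat
    have hs : s ∈ positiveLevels ℓ := ⟨ht.trans_le hts, ha⟩
    have h1 : (fun x => ℓ (S x)) ⁻¹' Ici (ℓ s) ∩ {x | t < S x}
        = {x | t < S x} \ {x | s < S x} := by
      ext x
      constructor
      · rintro ⟨hx, hx'⟩
        exact ⟨hx', fun hlt => (h.apply_lt hs hlt).not_ge hx⟩
      · rintro ⟨hx, hx'⟩
        exact ⟨h.antitoneOn (ht.trans hx) hs.1 (not_lt.1 hx'), hx⟩
    have hsub : {x | s < S x} ⊆ {x | t < S x} := fun x hx => hts.trans_lt hx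
    rw [h1, measure_sdiff hsub (hset s).nullMeasurableSet
      (by rw [hm s hs.1]; exact ENNReal.ofReal_ne_top), hm t ht, hm s hs.1,
      ENNReal.ofReal_sub _ ha.le]
  · have h1 : (fun x => ℓ (S x)) ⁻¹' Ici a ∩ {x | t < S x} = ∅ := by
      refine eq_empty_of_forall_notMem fun x hx => ?_
      exact (hat.trans_le hx.1).not_ge (h.antitoneOn ht (ht.trans hx.2) hx.2.le)
    rw [h1, measure_empty, ENNReal.ofReal_of_nonpos (sub_nonpos.2 hat.le)]

theorem MemLambda.measure_apply_eq_zero (h : MemLambda k ℓ) (hℓm : Measurable ℓ)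
    (hS : Measurable S) (hm : ∀ t, 0 < t → m {x | t < S x} = ENNReal.ofReal (ℓ t)) {t : ℝ}
    (ht : 0 < t) : m {x | t < S x ∧ ℓ (S x) = 0} = 0 := by
  have hcomp : Measurable fun x => ℓ (S x) := hℓm.comp hS
  have h1 : (m.restrict {x | t < S x}).map (fun x => ℓ (S x)) {0} = 0 := by
    rw [h.map_restrict_eq hℓm hS hm ht, measure_singleton]
  rw [Measure.map_apply hcomp (measurableSet_singleton 0),
    Measure.restrict_apply (hcomp (measurableSet_singleton 0))] at h1
  refine measure_mono_null ?_ h1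
  exact fun x hx => ⟨hx.2, hx.1⟩

theorem MemLambda.setIntegral_levelRadius (h : MemLambda k ℓ) (hℓm : Measurable ℓ)
    (hS : Measurable S) (hm : ∀ t, 0 < t → m {x | t < S x} = ENNReal.ofReal (ℓ t)) {t : ℝ}
    (ht : t ∈ positiveLevels ℓ) {ψ : ℝ → ℝ} (hψ : Continuous ψ) :
    ∫ x in {x | t < S x}, ψ (levelRadius k ℓ (S x)) ∂m
      = ℓ t * ∫ u in (0 : ℝ)..1, ψ (u ^ (1 / k) * levelRadius k ℓ t) := by
  have hmeas : Measurable fun w : ℝ => ψ (w ^ (1 / k)) :=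
    hψ.measurable.comp (measurable_id.pow_const _)
  calc ∫ x in {x | t < S x}, ψ (levelRadius k ℓ (S x)) ∂m
      = ∫ w, ψ (w ^ (1 / k)) ∂((m.restrict {x | t < S x}).map (fun x => ℓ (S x))) :=
        (integral_map (hℓm.comp hS).aemeasurable hmeas.aestronglyMeasurable).symm
    _ = ∫ w in (0 : ℝ)..ℓ t, ψ (w ^ (1 / k)) := by
        rw [h.map_restrict_eq hℓm hS hm ht.1, intervalIntegral.integral_of_le ht.2.le]
    _ = ℓ t * ∫ u in (0 : ℝ)..1, ψ ((ℓ t * u) ^ (1 / k)) := by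
        rw [intervalIntegral.integral_comp_mul_left (fun w => ψ (w ^ (1 / k))) ht.2.ne',
          smul_eq_mul, mul_zero, mul_one, mul_inv_cancel_left₀ ht.2.ne']
    _ = _ := by
        congr 1
        refine intervalIntegral.integral_congr fun u hu => ?_
        rw [uIcc_of_le zero_le_one] at hu
        simp only [levelRadius]
        rw [mul_comm, Real.mul_rpow hu.1 ht.2.le]

end Distribution

theorem integral_rpow_inv_mul_le {k L a b : ℝ} (hk : 0 < k) {ψ : ℝ → ℝ}
    (hψ : ∀ x y, |ψ x - ψ y| ≤ L * |x - y|) (hc : Continuous ψ) :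
    |(∫ u in (0 : ℝ)..1, ψ (u ^ (1 / k) * a)) - ∫ u in (0 : ℝ)..1, ψ (u ^ (1 / k) * b)|
      ≤ k / (k + 1) * L * |a - b| := by
  have hpow : Continuous fun u : ℝ => u ^ (1 / k) :=
    continuous_id.rpow_const fun _ => Or.inr (by positivity)
  have hi : ∀ a, IntervalIntegrable (fun u : ℝ => ψ (u ^ (1 / k) * a)) volume 0 1 := fun a =>
    (hc.comp (hpow.mul continuous_const)).intervalIntegrable _ _
  rw [← intervalIntegral.integral_sub (hi a) (hi b), ← Real.norm_eq_abs]
  have hI : ∫ u in (0 : ℝ)..1, u ^ (1 / k) = k / (k + 1) := by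
    have : (0 : ℝ) < 1 / k := by positivity
    rw [integral_rpow (Or.inl (by linarith)), Real.one_rpow, Real.zero_rpow (by positivity)]
    field_simp
    ring
  calc _ ≤ ∫ u in (0 : ℝ)..1, u ^ (1 / k) * (L * |a - b|) := by
        refine intervalIntegral.norm_integral_le_of_norm_le zero_le_one
          (Eventually.of_forall fun u hu => ?_) ((hpow.mul continuous_const).intervalIntegrable _ _)
        rw [Real.norm_eq_abs]
        refine (hψ _ _).trans (le_of_eq ?_)
        rw [← mul_sub, abs_mul, abs_of_nonneg (Real.rpow_nonneg hu.1.le _)]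
        ring
    _ = k / (k + 1) * L * |a - b| := by
        rw [intervalIntegral.integral_mul_const, hI]
        ring

end LevelFunction

section Target

variable {d : ℕ} {ϱ₀ ϱ₁ : EuclideanSpace ℝ (Fin d) → ℝ≥0}

theorem sliceMass_eq_withDensity (h₁ : Measurable ϱ₁) (t : ℝ) :
    sliceMass ϱ₀ ϱ₁ t
      = (volume.withDensity fun y => (ϱ₀ y : ℝ≥0∞)) {y | t < (ϱ₁ y : ℝ)} := by
  rw [withDensity_apply _ (measurableSet_slice h₁ t)]
  rfl

theorem updateKernel_apply_eq_restrict (h₀ : Measurable ϱ₀) (h₁ : Measurable ϱ₁) (t : ℝ) :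
    updateKernel ϱ₀ ϱ₁ t = (sliceMass ϱ₀ ϱ₁ t)⁻¹ •
      (volume.withDensity fun y => (ϱ₀ y : ℝ≥0∞)).restrict {y | t < (ϱ₁ y : ℝ)} := by
  rw [updateKernel_apply h₀ h₁, restrict_withDensity (measurableSet_slice h₁ t)]

theorem updateKernel_univ_le_one (h₀ : Measurable ϱ₀) (h₁ : Measurable ϱ₁) (t : ℝ) :
    updateKernel ϱ₀ ϱ₁ t univ ≤ 1 := by
  rw [updateKernel_apply_eq_restrict h₀ h₁, Measure.smul_apply, Measure.restrict_apply_univ,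
    ← sliceMass_eq_withDensity h₁, smul_eq_mul]
  exact ENNReal.inv_mul_le_one _

theorem measurable_levelFun (h₀ : Measurable ϱ₀) (h₁ : Measurable ϱ₁) :
    Measurable (levelFun ϱ₀ ϱ₁) :=
  (measurable_sliceMass h₀ h₁).ennreal_toReal

theorem levelFun_nonneg (t : ℝ) : 0 ≤ levelFun ϱ₀ ϱ₁ t := ENNReal.toReal_nonneg

theorem withDensity_slice_eq (h₁ : Measurable ϱ₁)
    (hint : ∫⁻ x, (ϱ₀ x : ℝ≥0∞) * ϱ₁ x ≠ ∞) (t : ℝ) (ht : 0 < t) :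
    (volume.withDensity fun y => (ϱ₀ y : ℝ≥0∞)) {y | t < (ϱ₁ y : ℝ)}
      = ENNReal.ofReal (levelFun ϱ₀ ϱ₁ t) := by
  rw [levelFun, ENNReal.ofReal_toReal (sliceMass_ne_top h₁ hint ht), sliceMass_eq_withDensity h₁]

/-- The joint distribution of a point drawn from the target and its threshold. -/
theorem lintegral_lintegral_thresholdKernel (h₀ : Measurable ϱ₀) (h₁ : Measurable ϱ₁)
    {F : EuclideanSpace ℝ (Fin d) → ℝ → ℝ≥0∞} (hF : Measurable (Function.uncurry F)) :
    ∫⁻ x, (ϱ₀ x : ℝ≥0∞) * ϱ₁ x * ∫⁻ t, F x t ∂(thresholdKernel ϱ₁ x)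
      = ∫⁻ t in Ioi (0 : ℝ), ∫⁻ x in {y | t < (ϱ₁ y : ℝ)}, F x t
          ∂(volume.withDensity fun y => (ϱ₀ y : ℝ≥0∞)) := by
  have hm := (measurable_sliceInd h₀ h₁).mul (hF.comp measurable_swap)
  calc ∫⁻ x, (ϱ₀ x : ℝ≥0∞) * ϱ₁ x * ∫⁻ t, F x t ∂(thresholdKernel ϱ₁ x)
      = ∫⁻ x, ∫⁻ t in Ioi (0 : ℝ),
          {y | t < (ϱ₁ y : ℝ)}.indicator (fun y => (ϱ₀ y : ℝ≥0∞)) x * F x t := by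
        refine lintegral_congr fun x => ?_
        rw [mul_assoc, lintegral_thresholdKernel h₁,
          ← lintegral_const_mul' _ _ ENNReal.coe_ne_top]
        refine lintegral_congr fun t => ?_
        by_cases hx : t < (ϱ₁ x : ℝ) <;> simp [indicator, hx]
    _ = ∫⁻ t in Ioi (0 : ℝ), ∫⁻ x,
          {y | t < (ϱ₁ y : ℝ)}.indicator (fun y => (ϱ₀ y : ℝ≥0∞)) x * F x t :=
        lintegral_lintegral_swap (hm.comp measurable_swap).aemeasurable
    _ = _ := by
        refine lintegral_congr fun t => ?_
        rw [restrict_withDensity (measurableSet_slice h₁ t),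
          lintegral_withDensity_eq_lintegral_mul _ h₀.coe_nnreal_ennreal (hF.of_uncurry_right),
          ← lintegral_indicator (measurableSet_slice h₁ t)]
        refine lintegral_congr fun x => ?_
        by_cases hx : t < (ϱ₁ x : ℝ) <;> simp [indicator, hx]

variable {π : Measure (EuclideanSpace ℝ (Fin d))} {ϱ : EuclideanSpace ℝ (Fin d) → ℝ≥0}

theorem HasDensity.lintegral_eq (hπ : HasDensity π ϱ) {g : EuclideanSpace ℝ (Fin d) → ℝ≥0∞}
    (hg : Measurable g) :
    ∫⁻ x, g x ∂π = (∫⁻ x, (ϱ x : ℝ≥0∞))⁻¹ * ∫⁻ x, (ϱ x : ℝ≥0∞) * g x := by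
  conv_lhs => rw [hπ.eq_withDensity]
  rw [lintegral_smul_measure,
    lintegral_withDensity_eq_lintegral_mul _ hπ.measurable.coe_nnreal_ennreal hg]
  rfl

theorem HasDensity.lintegral_mul_ne_top (hπ : HasDensity π ϱ) (hfac : ∀ x, ϱ x = ϱ₀ x * ϱ₁ x) :
    ∫⁻ x, (ϱ₀ x : ℝ≥0∞) * ϱ₁ x ≠ ∞ := by
  simpa [hfac] using hπ.lintegral_ne_top

theorem sliceKernel_isReversible [IsProbabilityMeasure π] (h₀ : Measurable ϱ₀)
    (h₁ : Measurable ϱ₁) (hfac : ∀ x, ϱ x = ϱ₀ x * ϱ₁ x) (hπ : HasDensity π ϱ) :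
    (sliceKernel ϱ₀ ϱ₁).IsReversible π := by
  classical
  have key : ∀ {A B : Set (EuclideanSpace ℝ (Fin d))}, MeasurableSet A → MeasurableSet B →
      ∫⁻ x in A, sliceKernel ϱ₀ ϱ₁ x B ∂π = (∫⁻ x, (ϱ x : ℝ≥0∞))⁻¹ * ∫⁻ t in Ioi (0 : ℝ),
        (sliceMass ϱ₀ ϱ₁ t)⁻¹ * ((volume.withDensity fun y => (ϱ₀ y : ℝ≥0∞)).restrict
            {y | t < (ϱ₁ y : ℝ)} A * (volume.withDensity fun y => (ϱ₀ y : ℝ≥0∞)).restrict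
            {y | t < (ϱ₁ y : ℝ)} B) := by
    intro A B hA hB
    have hU : Measurable fun t => updateKernel ϱ₀ ϱ₁ t B := Kernel.measurable_coe _ hB
    have hF : Measurable (Function.uncurry fun (x : EuclideanSpace ℝ (Fin d)) (t : ℝ) =>
        A.indicator 1 x * updateKernel ϱ₀ ϱ₁ t B) :=
      ((measurable_one.indicator hA).comp measurable_fst).mul (hU.comp measurable_snd)
    have hstep : ∫⁻ x in A, sliceKernel ϱ₀ ϱ₁ x B ∂π
        = ∫⁻ x, ∫⁻ t, A.indicator 1 x * updateKernel ϱ₀ ϱ₁ t B ∂(thresholdKernel ϱ₁ x) ∂π := by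
      rw [← lintegral_indicator hA]
      refine lintegral_congr_ae ?_
      filter_upwards [ae_goodPoints h₀ h₁ hfac hπ] with x hx
      rw [lintegral_const_mul _ hU]
      by_cases hxA : x ∈ A
      · rw [indicator_of_mem hxA, indicator_of_mem hxA, Pi.one_apply, one_mul, sliceKernel,
          Kernel.piecewise_apply, if_pos (by exact hx), sliceStep, Kernel.comp_apply' _ _ _ hB]
      · simp [hxA]
    have hm : Measurable fun x => ∫⁻ t, A.indicator 1 x * updateKernel ϱ₀ ϱ₁ t B
        ∂(thresholdKernel ϱ₁ x) := by
      simp only [lintegral_const_mul _ hU]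
      exact (measurable_one.indicator hA).mul hU.lintegral_kernel
    rw [hstep, hπ.lintegral_eq hm]
    simp only [hfac, ENNReal.coe_mul]
    rw [lintegral_lintegral_thresholdKernel h₀ h₁ hF]
    congr 1
    refine lintegral_congr fun t => ?_
    rw [lintegral_mul_const _ (measurable_one.indicator hA), lintegral_indicator_one hA,
      updateKernel_apply_eq_restrict h₀ h₁, Measure.smul_apply, smul_eq_mul, mul_left_comm]
  intro A B hA hB
  rw [key hA hB, key hB hA]
  simp only [mul_comm]

end Target

section Dynamics

variable {d : ℕ} {ϱ₀ ϱ₁ : EuclideanSpace ℝ (Fin d) → ℝ≥0} {k : ℝ}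
  {π : Measure (EuclideanSpace ℝ (Fin d))} {ϱ : EuclideanSpace ℝ (Fin d) → ℝ≥0}

theorem sliceMass_ne_zero {t : ℝ} (ht : t ∈ positiveLevels (levelFun ϱ₀ ϱ₁)) :
    sliceMass ϱ₀ ϱ₁ t ≠ 0 := fun h0 => by
  have := ht.2
  rw [levelFun, h0] at this
  simp at this

theorem thresholdKernel_isProbabilityMeasure (h₁ : Measurable ϱ₁) {x : EuclideanSpace ℝ (Fin d)}
    (hx : 0 < (ϱ₁ x : ℝ)) : IsProbabilityMeasure (thresholdKernel ϱ₁ x) := by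
  refine ⟨?_⟩
  rw [thresholdKernel_apply h₁, Measure.smul_apply, Measure.restrict_apply_univ, Real.volume_Ioo,
    sub_zero, ENNReal.ofReal_coe_nnreal, smul_eq_mul]
  exact ENNReal.inv_mul_cancel (by simpa using hx.ne') ENNReal.coe_ne_top

theorem sliceKernel_apply_eq_sliceStep (h₀ : Measurable ϱ₀) (h₁ : Measurable ϱ₁)
    (hint : ∫⁻ x, (ϱ₀ x : ℝ≥0∞) * ϱ₁ x ≠ ∞) (hℓ : MemLambda k (levelFun ϱ₀ ϱ₁))
    {x : EuclideanSpace ℝ (Fin d)} (hx : (ϱ₁ x : ℝ) ∈ positiveLevels (levelFun ϱ₀ ϱ₁)) :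
    sliceKernel ϱ₀ ϱ₁ x = sliceStep ϱ₀ ϱ₁ x := by
  classical
  have hprob := thresholdKernel_isProbabilityMeasure h₁ hx.1
  have hgood : sliceStep ϱ₀ ϱ₁ x univ = 1 := by
    rw [sliceStep, Kernel.comp_apply' _ _ _ MeasurableSet.univ]
    have hae : ∀ᵐ t ∂(thresholdKernel ϱ₁ x), updateKernel ϱ₀ ϱ₁ t univ = 1 := by
      rw [thresholdKernel_apply h₁]
      refine Measure.ae_smul_measure ?_ _
      filter_upwards [ae_restrict_mem measurableSet_Ioo] with t ht
      have htI := hℓ.mem_positiveLevels_of_le hx ht.1 ht.2.le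
      rw [updateKernel_apply_eq_restrict h₀ h₁, Measure.smul_apply, Measure.restrict_apply_univ,
        ← sliceMass_eq_withDensity h₁, smul_eq_mul,
        ENNReal.inv_mul_cancel (sliceMass_ne_zero htI) (sliceMass_ne_top h₁ hint ht.1)]
    rw [lintegral_congr_ae hae]
    simp
  rw [sliceKernel, Kernel.piecewise_apply, if_pos (by exact hgood)]

theorem integral_thresholdKernel (h₁ : Measurable ϱ₁) {x : EuclideanSpace ℝ (Fin d)} (h : ℝ → ℝ) :
    ∫ t, h t ∂(thresholdKernel ϱ₁ x) = (ϱ₁ x : ℝ)⁻¹ * ∫ t in (0 : ℝ)..ϱ₁ x, h t := by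
  rw [thresholdKernel_apply h₁, integral_smul_measure,
    intervalIntegral.integral_of_le (ϱ₁ x).coe_nonneg, integral_Ioc_eq_integral_Ioo, smul_eq_mul]
  simp

theorem integral_sliceKernel (h₀ : Measurable ϱ₀) (h₁ : Measurable ϱ₁)
    (hint : ∫⁻ x, (ϱ₀ x : ℝ≥0∞) * ϱ₁ x ≠ ∞) (hℓ : MemLambda k (levelFun ϱ₀ ϱ₁))
    {x : EuclideanSpace ℝ (Fin d)} (hx : (ϱ₁ x : ℝ) ∈ positiveLevels (levelFun ϱ₀ ϱ₁))
    {g : EuclideanSpace ℝ (Fin d) → ℝ} (hg : Integrable g (sliceKernel ϱ₀ ϱ₁ x)) :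
    ∫ y, g y ∂(sliceKernel ϱ₀ ϱ₁ x)
      = (ϱ₁ x : ℝ)⁻¹ * ∫ t in (0 : ℝ)..ϱ₁ x, ∫ y, g y ∂(updateKernel ϱ₀ ϱ₁ t) := by
  rw [sliceKernel_apply_eq_sliceStep h₀ h₁ hint hℓ hx] at hg ⊢
  rw [sliceStep, Kernel.integral_comp hg, integral_thresholdKernel h₁]

theorem integral_updateKernel (h₀ : Measurable ϱ₀) (h₁ : Measurable ϱ₁)
    (hint : ∫⁻ x, (ϱ₀ x : ℝ≥0∞) * ϱ₁ x ≠ ∞) (hℓ : MemLambda k (levelFun ϱ₀ ϱ₁))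
    {t : ℝ} (ht : t ∈ positiveLevels (levelFun ϱ₀ ϱ₁)) {f : EuclideanSpace ℝ (Fin d) → ℝ}
    {ψ : ℝ → ℝ} (hψ : Continuous ψ)
    (hf : ∀ x, (ϱ₁ x : ℝ) ∈ positiveLevels (levelFun ϱ₀ ϱ₁) →
      f x = ψ (levelRadius k (levelFun ϱ₀ ϱ₁) (ϱ₁ x))) :
    ∫ y, f y ∂(updateKernel ϱ₀ ϱ₁ t)
      = ∫ u in (0 : ℝ)..1, ψ (u ^ (1 / k) * levelRadius k (levelFun ϱ₀ ϱ₁) t) := by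
  have hS : Measurable fun x => (ϱ₁ x : ℝ) := h₁.coe_nnreal_real
  have hm := withDensity_slice_eq h₁ hint
  have hℓm := measurable_levelFun h₀ h₁
  have hae : ∀ᵐ x ∂((volume.withDensity fun y => (ϱ₀ y : ℝ≥0∞)).restrict {y | t < (ϱ₁ y : ℝ)}),
      f x = ψ (levelRadius k (levelFun ϱ₀ ϱ₁) (ϱ₁ x)) := by
    have hnull := hℓ.measure_apply_eq_zero hℓm hS hm ht.1
    rw [ae_restrict_iff' (measurableSet_slice h₁ t)]
    filter_upwards [measure_eq_zero_iff_ae_notMem.1 hnull] with x hx htx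
    have htx' : t < (ϱ₁ x : ℝ) := htx
    exact hf x ⟨ht.1.trans htx', lt_of_le_of_ne (levelFun_nonneg _) fun h0 => hx ⟨htx, h0.symm⟩⟩
  rw [updateKernel_apply_eq_restrict h₀ h₁, integral_smul_measure, integral_congr_ae hae,
    hℓ.setIntegral_levelRadius hℓm hS hm ht hψ, ENNReal.toReal_inv, smul_eq_mul, ← levelFun,
    inv_mul_cancel_left₀ ht.2.ne']

/-- Bounded functions that are Lipschitz in the radial coordinate of `ϱ₁`. -/
structure IsRadialLipschitz (k : ℝ) (ϱ₀ ϱ₁ : EuclideanSpace ℝ (Fin d) → ℝ≥0) (L M : ℝ)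
    (f : EuclideanSpace ℝ (Fin d) → ℝ) : Prop where
  measurable : Measurable f
  abs_le : ∀ x, |f x| ≤ M
  abs_sub_le : ∀ x y, (ϱ₁ x : ℝ) ∈ positiveLevels (levelFun ϱ₀ ϱ₁) →
    (ϱ₁ y : ℝ) ∈ positiveLevels (levelFun ϱ₀ ϱ₁) →
    |f x - f y| ≤ L * |levelRadius k (levelFun ϱ₀ ϱ₁) (ϱ₁ x)
      - levelRadius k (levelFun ϱ₀ ϱ₁) (ϱ₁ y)|

theorem exists_lipschitz_factor {X : Type*} {A : Set X} {R f : X → ℝ} {L : ℝ} (hL : 0 ≤ L)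
    (h : ∀ x ∈ A, ∀ y ∈ A, |f x - f y| ≤ L * |R x - R y|) :
    ∃ ψ : ℝ → ℝ, (∀ a b, |ψ a - ψ b| ≤ L * |a - b|) ∧ Continuous ψ ∧ ∀ x ∈ A, f x = ψ (R x) := by
  rcases isEmpty_or_nonempty X with hX | hX
  · exact ⟨0, fun a b => by simpa using mul_nonneg hL (abs_nonneg _), continuous_const,
      fun x => (hX.false x).elim⟩
  have hinv : ∀ r ∈ R '' A, Function.invFunOn R A r ∈ A ∧ R (Function.invFunOn R A r) = r :=
    fun r hr => ⟨Function.invFunOn_mem hr, Function.invFunOn_eq hr⟩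
  have hlip : LipschitzOnWith L.toNNReal (fun r => f (Function.invFunOn R A r)) (R '' A) := by
    refine LipschitzOnWith.of_dist_le_mul fun a ha b hb => ?_
    rw [Real.dist_eq, Real.dist_eq, Real.coe_toNNReal L hL]
    have := h _ (hinv a ha).1 _ (hinv b hb).1
    rwa [(hinv a ha).2, (hinv b hb).2] at this
  obtain ⟨ψ, hψ, heq⟩ := hlip.extend_real
  refine ⟨ψ, fun a b => ?_, hψ.continuous, fun x hx => ?_⟩
  · have := hψ.dist_le_mul a b
    rwa [Real.dist_eq, Real.dist_eq, Real.coe_toNNReal L hL] at this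
  · have hr : R x ∈ R '' A := mem_image_of_mem R hx
    rw [← heq hr]
    have := h x hx _ (hinv _ hr).1
    rw [(hinv _ hr).2, sub_self, abs_zero, mul_zero] at this
    exact sub_eq_zero.1 (abs_nonpos_iff.1 this)

namespace IsRadialLipschitz

variable {L M : ℝ} {f : EuclideanSpace ℝ (Fin d) → ℝ}

theorem integrable (hf : IsRadialLipschitz k ϱ₀ ϱ₁ L M f)
    (μ : Measure (EuclideanSpace ℝ (Fin d))) [IsFiniteMeasure μ] : Integrable f μ :=
  Integrable.of_bound hf.measurable.aestronglyMeasurable M (Eventually.of_forall hf.abs_le)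

theorem norm_le (hf : IsRadialLipschitz k ϱ₀ ϱ₁ L M f) (x : EuclideanSpace ℝ (Fin d)) :
    ‖f x‖ ≤ M := hf.abs_le x

theorem abs_integral_le (hf : IsRadialLipschitz k ϱ₀ ϱ₁ L M f)
    (μ : Measure (EuclideanSpace ℝ (Fin d))) [IsProbabilityMeasure μ] : |∫ x, f x ∂μ| ≤ M := by
  simpa using norm_integral_le_of_norm_le_const (μ := μ) (Eventually.of_forall hf.norm_le)

/-- The slice sampler contracts in the radial coordinate. -/
theorem integral_sliceKernel (h₀ : Measurable ϱ₀) (h₁ : Measurable ϱ₁)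
    (hint : ∫⁻ x, (ϱ₀ x : ℝ≥0∞) * ϱ₁ x ≠ ∞) (hk : 0 < k)
    (hℓ : MemLambda k (levelFun ϱ₀ ϱ₁)) (hL : 0 ≤ L) (hf : IsRadialLipschitz k ϱ₀ ϱ₁ L M f) :
    IsRadialLipschitz k ϱ₀ ϱ₁ (k / (k + 1) * L) M
      fun x => ∫ y, f y ∂(sliceKernel ϱ₀ ϱ₁ x) := by
  refine ⟨hf.measurable.stronglyMeasurable.integral_kernel.measurable,
    fun x => hf.abs_integral_le _, fun x y hx hy => ?_⟩
  obtain ⟨ψ, hψL, hψc, hψ⟩ := exists_lipschitz_factor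
    (A := {x | (ϱ₁ x : ℝ) ∈ positiveLevels (levelFun ϱ₀ ϱ₁)}) hL fun x hx y hy => hf.abs_sub_le x y hx hy
  set h : ℝ → ℝ := fun t => ∫ y, f y ∂(updateKernel ϱ₀ ϱ₁ t) with hh
  have hhm : Measurable h := hf.measurable.stronglyMeasurable.integral_kernel.measurable
  have hval : ∀ t ∈ positiveLevels (levelFun ϱ₀ ϱ₁),
      h t = ∫ u in (0 : ℝ)..1, ψ (u ^ (1 / k) * levelRadius k (levelFun ϱ₀ ϱ₁) t) := fun t ht =>
    integral_updateKernel h₀ h₁ hint hℓ ht hψc hψ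
  have hlip : ∀ s ∈ positiveLevels (levelFun ϱ₀ ϱ₁), ∀ t ∈ positiveLevels (levelFun ϱ₀ ϱ₁),
      |h s - h t| ≤ k / (k + 1) * L *
        |levelRadius k (levelFun ϱ₀ ϱ₁) s - levelRadius k (levelFun ϱ₀ ϱ₁) t| := by
    intro s hs t ht
    rw [hval s hs, hval t ht]
    exact integral_rpow_inv_mul_le hk hψL hψc
  have hM : 0 ≤ M := (abs_nonneg _).trans (hf.abs_le x)
  have hbound : ∀ t, |h t| ≤ M := by
    intro t
    have hle := updateKernel_univ_le_one h₀ h₁ t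
    have hfin : IsFiniteMeasure (updateKernel ϱ₀ ϱ₁ t) := ⟨hle.trans_lt ENNReal.one_lt_top⟩
    refine (norm_integral_le_of_norm_le_const (Eventually.of_forall hf.norm_le)).trans ?_
    exact mul_le_of_le_one_right hM
      ((ENNReal.toReal_mono ENNReal.one_ne_top hle).trans_eq ENNReal.toReal_one)
  have hP : ∀ x, (ϱ₁ x : ℝ) ∈ positiveLevels (levelFun ϱ₀ ϱ₁) →
      ∫ y, f y ∂(sliceKernel ϱ₀ ϱ₁ x) = ∫ v in (0 : ℝ)..1, h (ϱ₁ x * v) := by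
    intro x hx
    rw [SliceSampling.integral_sliceKernel h₀ h₁ hint hℓ hx (hf.integrable _),
      intervalIntegral.integral_comp_mul_left h hx.1.ne', mul_zero, mul_one, smul_eq_mul]
  have hi : ∀ s, IntervalIntegrable (fun v => h (s * v)) volume 0 1 := by
    intro s
    rw [intervalIntegrable_iff_integrableOn_Ioc_of_le zero_le_one]
    exact Integrable.of_bound (hhm.comp (measurable_const_mul s)).aestronglyMeasurable M
      (Eventually.of_forall fun v => hbound _)
  rw [hP x hx, hP y hy, ← intervalIntegral.integral_sub (hi _) (hi _), ← Real.norm_eq_abs]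
  refine (intervalIntegral.norm_integral_le_of_norm_le_const
    (C := k / (k + 1) * L *
      |levelRadius k (levelFun ϱ₀ ϱ₁) (ϱ₁ x) - levelRadius k (levelFun ϱ₀ ϱ₁) (ϱ₁ y)|)
    fun v hv => ?_).trans (by simp)
  rw [uIoc_of_le zero_le_one] at hv
  rw [Real.norm_eq_abs, mul_comm _ v, mul_comm _ v]
  refine (hlip _ (hℓ.mem_positiveLevels_of_le hx (mul_pos hv.1 hx.1)
    (mul_le_of_le_one_left hx.1.le hv.2)) _ (hℓ.mem_positiveLevels_of_le hy (mul_pos hv.1 hy.1)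
    (mul_le_of_le_one_left hy.1.le hv.2))).trans ?_
  exact mul_le_mul_of_nonneg_left (hℓ.abs_levelRadius_mul_sub_le hk hx hy hv.1 hv.2)
    (by positivity)

theorem iterate (h₀ : Measurable ϱ₀) (h₁ : Measurable ϱ₁)
    (hint : ∫⁻ x, (ϱ₀ x : ℝ≥0∞) * ϱ₁ x ≠ ∞) (hk : 0 < k)
    (hℓ : MemLambda k (levelFun ϱ₀ ϱ₁)) (hL : 0 ≤ L) (hf : IsRadialLipschitz k ϱ₀ ϱ₁ L M f)
    (n : ℕ) :
    IsRadialLipschitz k ϱ₀ ϱ₁ ((k / (k + 1)) ^ n * L) M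
      ((fun g x => ∫ y, g y ∂(sliceKernel ϱ₀ ϱ₁ x))^[n] f) := by
  induction n with
  | zero => simpa using hf
  | succ n ih =>
    rw [Function.iterate_succ_apply', pow_succ', mul_assoc]
    exact ih.integral_sliceKernel h₀ h₁ hint hk hℓ (by positivity)

end IsRadialLipschitz

end Dynamics

section Mixing

variable {d : ℕ} {ϱ₀ ϱ₁ : EuclideanSpace ℝ (Fin d) → ℝ≥0} {k : ℝ}
  {π : Measure (EuclideanSpace ℝ (Fin d))} {ϱ : EuclideanSpace ℝ (Fin d) → ℝ≥0}

theorem measurable_levelRadius (h₀ : Measurable ϱ₀) (h₁ : Measurable ϱ₁) :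
    Measurable fun x => levelRadius k (levelFun ϱ₀ ϱ₁) (ϱ₁ x) :=
  ((measurable_levelFun h₀ h₁).comp h₁.coe_nnreal_real).pow_const _

theorem levelRadius_levelFun_nonneg (t : ℝ) : 0 ≤ levelRadius k (levelFun ϱ₀ ϱ₁) t :=
  Real.rpow_nonneg (levelFun_nonneg t) _

theorem lintegral_levelFun (h₀ : Measurable ϱ₀) (h₁ : Measurable ϱ₁)
    (hint : ∫⁻ x, (ϱ₀ x : ℝ≥0∞) * ϱ₁ x ≠ ∞) :
    ∫⁻ t in Ioi (0 : ℝ), ENNReal.ofReal (levelFun ϱ₀ ϱ₁ t) = ∫⁻ x, (ϱ₀ x : ℝ≥0∞) * ϱ₁ x := by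
  have h := lintegral_lintegral_thresholdKernel h₀ h₁ (F := fun _ _ => 1) measurable_const
  calc ∫⁻ t in Ioi (0 : ℝ), ENNReal.ofReal (levelFun ϱ₀ ϱ₁ t)
      = ∫⁻ t in Ioi (0 : ℝ), ∫⁻ _ in {y | t < (ϱ₁ y : ℝ)}, 1
          ∂(volume.withDensity fun y => (ϱ₀ y : ℝ≥0∞)) := by
        refine setLIntegral_congr_fun measurableSet_Ioi fun t ht => ?_
        simp only [setLIntegral_one]
        rw [withDensity_slice_eq h₁ hint t ht]
    _ = ∫⁻ x, (ϱ₀ x : ℝ≥0∞) * ϱ₁ x := by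
        rw [← h]
        refine lintegral_congr fun x => ?_
        by_cases hx : ϱ₁ x = 0
        · simp [hx]
        · have := thresholdKernel_isProbabilityMeasure h₁ (x := x) (by
            exact_mod_cast pos_iff_ne_zero.2 hx)
          simp

theorem positiveLevels_nonempty (h₀ : Measurable ϱ₀) (h₁ : Measurable ϱ₁)
    (hfac : ∀ x, ϱ x = ϱ₀ x * ϱ₁ x) (hπ : HasDensity π ϱ) :
    (positiveLevels (levelFun ϱ₀ ϱ₁)).Nonempty := by
  by_contra hne
  apply hπ.lintegral_ne_zero
  simp only [hfac, ENNReal.coe_mul]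
  rw [← lintegral_levelFun h₀ h₁ (hπ.lintegral_mul_ne_top hfac),
    setLIntegral_congr_fun (g := fun _ => 0) measurableSet_Ioi, lintegral_zero]
  intro t ht
  exact ENNReal.ofReal_of_nonpos (not_lt.1 fun hpos => hne ⟨t, ht, hpos⟩)

theorem ae_mem_positiveLevels (h₀ : Measurable ϱ₀) (h₁ : Measurable ϱ₁)
    (hfac : ∀ x, ϱ x = ϱ₀ x * ϱ₁ x) (hπ : HasDensity π ϱ) (hℓ : MemLambda k (levelFun ϱ₀ ϱ₁)) :
    ∀ᵐ x ∂π, (ϱ₁ x : ℝ) ∈ positiveLevels (levelFun ϱ₀ ϱ₁) := by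
  obtain ⟨t, ht⟩ := positiveLevels_nonempty h₀ h₁ hfac hπ
  have hnull := hℓ.measure_apply_eq_zero (measurable_levelFun h₀ h₁) h₁.coe_nnreal_real
    (withDensity_slice_eq h₁ (hπ.lintegral_mul_ne_top hfac)) ht.1
  have hae : ∀ᵐ x ∂(volume.withDensity fun y => (ϱ₀ y : ℝ≥0∞)),
      ¬(t < (ϱ₁ x : ℝ) ∧ levelFun ϱ₀ ϱ₁ (ϱ₁ x) = 0) := measure_eq_zero_iff_ae_notMem.1 hnull
  rw [ae_withDensity_iff h₀.coe_nnreal_ennreal] at hae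
  rw [hπ.eq_withDensity]
  refine Measure.ae_smul_measure ?_ _
  rw [ae_withDensity_iff hπ.measurable.coe_nnreal_ennreal]
  filter_upwards [hae] with x hx hϱ
  rw [hfac, ENNReal.coe_mul] at hϱ
  have hpos : 0 < (ϱ₁ x : ℝ) := by
    have : ϱ₁ x ≠ 0 := by simpa using right_ne_zero_of_mul hϱ
    exact_mod_cast pos_iff_ne_zero.2 this
  by_cases htx : t < (ϱ₁ x : ℝ)
  · exact ⟨hpos, lt_of_le_of_ne (levelFun_nonneg _)
      fun h0 => hx (left_ne_zero_of_mul hϱ) ⟨htx, h0.symm⟩⟩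
  · exact hℓ.mem_positiveLevels_of_le ht hpos (not_lt.1 htx)

theorem integrable_levelRadius (h₀ : Measurable ϱ₀) (h₁ : Measurable ϱ₁)
    (hfac : ∀ x, ϱ x = ϱ₀ x * ϱ₁ x) (hπ : HasDensity π ϱ) (hk : 0 < k)
    (hℓ : MemLambda k (levelFun ϱ₀ ϱ₁)) :
    Integrable (fun x => levelRadius k (levelFun ϱ₀ ϱ₁) (ϱ₁ x)) π := by
  have hint := hπ.lintegral_mul_ne_top hfac
  have hm := measurable_levelRadius (k := k) h₀ h₁
  refine ⟨hm.aestronglyMeasurable, ?_⟩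
  rw [hasFiniteIntegral_iff_ofReal
    (Eventually.of_forall fun x => levelRadius_levelFun_nonneg _), hπ.lintegral_eq hm.ennreal_ofReal]
  refine ENNReal.mul_lt_top (ENNReal.inv_lt_top.2 (pos_iff_ne_zero.2 hπ.lintegral_ne_zero)) ?_
  have hF : Measurable (Function.uncurry fun (x : EuclideanSpace ℝ (Fin d)) (_ : ℝ) =>
      ENNReal.ofReal (levelRadius k (levelFun ϱ₀ ϱ₁) (ϱ₁ x))) :=
    hm.ennreal_ofReal.comp measurable_fst
  calc ∫⁻ x, (ϱ x : ℝ≥0∞) * ENNReal.ofReal (levelRadius k (levelFun ϱ₀ ϱ₁) (ϱ₁ x))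
      = ∫⁻ x, (ϱ₀ x : ℝ≥0∞) * ϱ₁ x * ∫⁻ _, ENNReal.ofReal
          (levelRadius k (levelFun ϱ₀ ϱ₁) (ϱ₁ x)) ∂(thresholdKernel ϱ₁ x) := by
        refine lintegral_congr fun x => ?_
        rw [hfac, ENNReal.coe_mul]
        by_cases hx : ϱ₁ x = 0
        · simp [hx]
        · have := thresholdKernel_isProbabilityMeasure h₁ (x := x) (by
            exact_mod_cast pos_iff_ne_zero.2 hx)
          simp
    _ ≤ ∫⁻ t in Ioi (0 : ℝ), ENNReal.ofReal (levelRadius k (levelFun ϱ₀ ϱ₁) t)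
          * ENNReal.ofReal (levelFun ϱ₀ ϱ₁ t) := by
        rw [lintegral_lintegral_thresholdKernel h₀ h₁ hF]
        refine setLIntegral_mono' measurableSet_Ioi fun t ht => ?_
        rw [← withDensity_slice_eq h₁ hint t ht, ← setLIntegral_const]
        refine setLIntegral_mono' (measurableSet_slice h₁ t) fun x hx => ?_
        have hx' : t < (ϱ₁ x : ℝ) := hx
        have ht' : (0 : ℝ) < t := ht
        exact ENNReal.ofReal_le_ofReal
          (hℓ.levelRadius_antitoneOn hk ht' (ht'.trans hx') hx'.le)
    _ < ∞ := (hℓ.lintegral_levelRadius_mul_ne_top hk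
        (by rwa [lintegral_levelFun h₀ h₁ hint])).lt_top

namespace IsRadialLipschitz

variable {L M : ℝ} {f : EuclideanSpace ℝ (Fin d) → ℝ}

theorem abs_sub_integral_le [IsProbabilityMeasure π] (hf : IsRadialLipschitz k ϱ₀ ϱ₁ L M f)
    (hae : ∀ᵐ x ∂π, (ϱ₁ x : ℝ) ∈ positiveLevels (levelFun ϱ₀ ϱ₁))
    (hR : Integrable (fun x => levelRadius k (levelFun ϱ₀ ϱ₁) (ϱ₁ x)) π) (hL : 0 ≤ L)
    {x : EuclideanSpace ℝ (Fin d)} (hx : (ϱ₁ x : ℝ) ∈ positiveLevels (levelFun ϱ₀ ϱ₁)) :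
    |f x - ∫ y, f y ∂π| ≤ L * (levelRadius k (levelFun ϱ₀ ϱ₁) (ϱ₁ x)
      + ∫ y, levelRadius k (levelFun ϱ₀ ϱ₁) (ϱ₁ y) ∂π) := by
  have h1 : f x - ∫ y, f y ∂π = ∫ y, (f x - f y) ∂π := by
    rw [integral_sub (integrable_const _) (hf.integrable π)]
    simp
  have h2 : ∫ y, L * (levelRadius k (levelFun ϱ₀ ϱ₁) (ϱ₁ x)
      + levelRadius k (levelFun ϱ₀ ϱ₁) (ϱ₁ y)) ∂π = L * (levelRadius k (levelFun ϱ₀ ϱ₁) (ϱ₁ x)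
      + ∫ y, levelRadius k (levelFun ϱ₀ ϱ₁) (ϱ₁ y) ∂π) := by
    rw [integral_const_mul, integral_add (integrable_const _) hR]
    simp
  rw [h1, ← h2, ← Real.norm_eq_abs]
  refine norm_integral_le_of_norm_le (((integrable_const _).add hR).const_mul L) ?_
  filter_upwards [hae] with y hy
  refine (hf.abs_sub_le x y hx hy).trans (mul_le_mul_of_nonneg_left ?_ hL)
  refine (abs_sub _ _).trans (le_of_eq ?_)
  rw [abs_of_nonneg (levelRadius_levelFun_nonneg _), abs_of_nonneg (levelRadius_levelFun_nonneg _)]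

/-- Correlations of radially Lipschitz functions decay geometrically. -/
theorem exists_abs_correlation_le [IsProbabilityMeasure π] (h₀ : Measurable ϱ₀)
    (h₁ : Measurable ϱ₁) (hfac : ∀ x, ϱ x = ϱ₀ x * ϱ₁ x) (hπ : HasDensity π ϱ) (hk : 0 < k)
    (hℓ : MemLambda k (levelFun ϱ₀ ϱ₁)) (hL : 0 ≤ L) (hf : IsRadialLipschitz k ϱ₀ ϱ₁ L M f) :
    ∃ C : ℝ, ∀ n : ℕ, |∫ x, ((fun g x => ∫ y, g y ∂(sliceKernel ϱ₀ ϱ₁ x))^[n] f) x * f x ∂π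
      - (∫ x, f x ∂π) ^ 2| ≤ C * (k / (k + 1)) ^ n := by
  have hint := hπ.lintegral_mul_ne_top hfac
  have hae := ae_mem_positiveLevels h₀ h₁ hfac hπ hℓ
  have hR := integrable_levelRadius h₀ h₁ hfac hπ hk hℓ
  have hinv := sliceKernel_invariant h₀ h₁ hfac hπ
  set F : ℕ → EuclideanSpace ℝ (Fin d) → ℝ :=
    fun n => (fun g x => ∫ y, g y ∂(sliceKernel ϱ₀ ϱ₁ x))^[n] f with hFdef
  have hF : ∀ n, IsRadialLipschitz k ϱ₀ ϱ₁ ((k / (k + 1)) ^ n * L) M (F n) :=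
    hf.iterate h₀ h₁ hint hk hℓ hL
  have hmean : ∀ n, ∫ x, F n x ∂π = ∫ x, f x ∂π := by
    intro n
    induction n with
    | zero => rfl
    | succ n ih =>
      rw [← ih]
      conv_rhs => rw [← hinv.def]
      rw [Measure.comp_eq_comp_const_apply, Kernel.integral_comp ((hF n).integrable _),
        Kernel.const_apply]
      simp only [hFdef, Function.iterate_succ_apply']
  set r := ∫ y, levelRadius k (levelFun ϱ₀ ϱ₁) (ϱ₁ y) ∂π with hr
  refine ⟨L * (r + r) * M, fun n => ?_⟩
  change |∫ x, F n x * f x ∂π - _| ≤ _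
  have hFf : Integrable (fun x => F n x * f x) π :=
    ((hF n).integrable π).mul_bdd hf.measurable.aestronglyMeasurable
      (Eventually.of_forall hf.norm_le)
  have h1 : ∫ x, F n x * f x ∂π - (∫ x, f x ∂π) ^ 2
      = ∫ x, (F n x - ∫ y, F n y ∂π) * f x ∂π := by
    simp only [sub_mul]
    rw [integral_sub hFf ((hf.integrable π).const_mul _), integral_const_mul, hmean, sq]
  have h2 : ∫ x, (k / (k + 1)) ^ n * L * (levelRadius k (levelFun ϱ₀ ϱ₁) (ϱ₁ x) + r) * M ∂π
      = L * (r + r) * M * (k / (k + 1)) ^ n := by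
    rw [integral_mul_const, integral_const_mul, integral_add hR (integrable_const _)]
    simp only [integral_const, probReal_univ, one_smul, ← hr]
    ring
  rw [h1, ← h2, ← Real.norm_eq_abs]
  refine norm_integral_le_of_norm_le
    (((hR.add (integrable_const _)).const_mul _).mul_const _) ?_
  filter_upwards [hae] with x hx
  rw [norm_mul]
  exact mul_le_mul ((hF n).abs_sub_integral_le hae hR (by positivity) hx) (hf.norm_le x)
    (norm_nonneg _) (mul_nonneg (by positivity) (add_nonneg (levelRadius_levelFun_nonneg _)
      (integral_nonneg fun y => levelRadius_levelFun_nonneg _)))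

end IsRadialLipschitz

/-- One step of the slice sampler turns every square-integrable function into a function of the
radial coordinate. -/
theorem exists_radial_factor [IsProbabilityMeasure π] (h₀ : Measurable ϱ₀)
    (h₁ : Measurable ϱ₁) (hfac : ∀ x, ϱ x = ϱ₀ x * ϱ₁ x) (hπ : HasDensity π ϱ) (hk : 0 < k)
    (hℓ : MemLambda k (levelFun ϱ₀ ϱ₁)) {g : EuclideanSpace ℝ (Fin d) → ℝ} (hg : MemLp g 2 π) :
    ∃ φ : ℝ → ℝ, AEMeasurable φ (π.map fun x => levelRadius k (levelFun ϱ₀ ϱ₁) (ϱ₁ x)) ∧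
      (fun x => ∫ y, g y ∂(sliceKernel ϱ₀ ϱ₁ x))
        =ᵐ[π] fun x => φ (levelRadius k (levelFun ϱ₀ ϱ₁) (ϱ₁ x)) := by
  have hint := hπ.lintegral_mul_ne_top hfac
  have hae := ae_mem_positiveLevels h₀ h₁ hfac hπ hℓ
  have hinv := sliceKernel_invariant h₀ h₁ hfac hπ
  have hRm := measurable_levelRadius (k := k) h₀ h₁
  have hgmk : ∀ᵐ x ∂π, g =ᵐ[sliceKernel ϱ₀ ϱ₁ x] hg.1.mk g :=
    Measure.ae_ae_of_ae_comp (by rw [hinv.def]; exact hg.1.ae_eq_mk)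
  have hgint : ∀ᵐ x ∂π, Integrable g (sliceKernel ϱ₀ ϱ₁ x) :=
    Measure.ae_integrable_of_integrable_comp (by rw [hinv.def]; exact hg.integrable one_le_two)
  set h : ℝ → ℝ := fun t => ∫ y, hg.1.mk g y ∂(updateKernel ϱ₀ ϱ₁ t) with hh
  have hhm : StronglyMeasurable h := hg.1.stronglyMeasurable_mk.integral_kernel
  set Φ : ℝ → ℝ := fun s => s⁻¹ * ∫ t, {p : ℝ × ℝ | 0 < p.2 ∧ p.2 ≤ p.1}.indicator
    (fun p => h p.2) (s, t) with hΦ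
  have hΦm : Measurable Φ := by
    have hset : MeasurableSet {p : ℝ × ℝ | 0 < p.2 ∧ p.2 ≤ p.1} :=
      (measurableSet_lt measurable_const measurable_snd).inter
        (measurableSet_le measurable_snd measurable_fst)
    exact measurable_inv.mul
      ((hhm.comp_measurable measurable_snd).indicator hset).integral_prod_right'.measurable
  have hΦeq : ∀ s, 0 < s → Φ s = s⁻¹ * ∫ t in (0 : ℝ)..s, h t := by
    intro s hs
    rw [intervalIntegral.integral_of_le hs.le, ← integral_indicator measurableSet_Ioc]
    rfl
  set J : Set ℝ := levelRadius k (levelFun ϱ₀ ϱ₁) '' positiveLevels (levelFun ϱ₀ ϱ₁) with hJ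
  have hJm : MeasurableSet J := by
    have hord : OrdConnected (positiveLevels (levelFun ϱ₀ ϱ₁)) :=
      ⟨fun s hs t ht u hu => hℓ.mem_positiveLevels_of_le ht (hs.1.trans_le hu.1) hu.2⟩
    refine (hord.isPreconnected.image _ ?_).ordConnected.measurableSet
    exact (hℓ.continuousOn.mono fun t ht => ht.1).rpow_const
      fun t ht => Or.inr (by positivity)
  have hanti : AntitoneOn (fun r => levelInv (levelFun ϱ₀ ϱ₁) (r ^ k)) J := by
    rintro _ ⟨s, hs, rfl⟩ _ ⟨t, ht, rfl⟩ hst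
    simp only [hℓ.levelInv_levelRadius_rpow hk hs, hℓ.levelInv_levelRadius_rpow hk ht]
    by_contra! hlt
    exact (hℓ.levelRadius_lt hk hs hlt).not_ge hst
  have hrestrict : (π.map fun x => levelRadius k (levelFun ϱ₀ ϱ₁) (ϱ₁ x)).restrict J
      = π.map fun x => levelRadius k (levelFun ϱ₀ ϱ₁) (ϱ₁ x) := by
    refine Measure.restrict_eq_self_of_ae_mem ?_
    refine (ae_map_iff (p := (· ∈ J)) hRm.aemeasurable hJm).2 ?_
    filter_upwards [hae] with x hx using mem_image_of_mem _ hx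
  refine ⟨fun r => Φ (levelInv (levelFun ϱ₀ ϱ₁) (r ^ k)), ?_, ?_⟩
  · rw [← hrestrict]
    exact hΦm.comp_aemeasurable (aemeasurable_restrict_of_antitoneOn hJm hanti)
  · filter_upwards [hae, hgmk, hgint] with x hx h2 h3
    rw [hℓ.levelInv_levelRadius_rpow hk hx, hΦeq _ hx.1, integral_congr_ae h2,
      integral_sliceKernel h₀ h₁ hint hℓ hx (h3.congr h2)]

theorem exists_isRadialLipschitz_eLpNorm_sub_le [IsProbabilityMeasure π] (h₀ : Measurable ϱ₀)
    (h₁ : Measurable ϱ₁) (hfac : ∀ x, ϱ x = ϱ₀ x * ϱ₁ x) (hπ : HasDensity π ϱ) (hk : 0 < k)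
    (hℓ : MemLambda k (levelFun ϱ₀ ϱ₁)) {g : EuclideanSpace ℝ (Fin d) → ℝ} (hg : MemLp g 2 π)
    {ε : ℝ} (hε : 0 < ε) :
    ∃ L M f, 0 ≤ L ∧ IsRadialLipschitz k ϱ₀ ϱ₁ L M f ∧
      eLpNorm (f - fun x => ∫ y, g y ∂(sliceKernel ϱ₀ ϱ₁ x)) 2 π ≤ ENNReal.ofReal ε := by
  have hRm := measurable_levelRadius (k := k) h₀ h₁
  obtain ⟨φ, hφm, hφ⟩ := exists_radial_factor h₀ h₁ hfac hπ hk hℓ hg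
  have hinv := sliceKernel_invariant h₀ h₁ hfac hπ
  have hφLp : MemLp φ 2 (π.map fun x => levelRadius k (levelFun ϱ₀ ϱ₁) (ϱ₁ x)) := by
    rw [memLp_map_measure_iff hφm.aestronglyMeasurable hRm.aemeasurable]
    exact (memLp_congr_ae hφ).1 (memLp_integral_kernel hinv hg).1
  have hprob := Measure.isProbabilityMeasure_map (μ := π) hRm.aemeasurable
  obtain ⟨ψ, hψs, hψd, hψ⟩ := hφLp.exist_eLpNorm_sub_le ENNReal.ofNat_ne_top one_le_two hε
  obtain ⟨L, hL⟩ := hψd.lipschitzWith_of_hasCompactSupport hψs (by simp)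
  obtain ⟨M, hM⟩ := hψs.exists_bound_of_continuous hψd.continuous
  refine ⟨L, M, fun x => ψ (levelRadius k (levelFun ϱ₀ ϱ₁) (ϱ₁ x)), L.coe_nonneg,
    ⟨hψd.continuous.measurable.comp hRm, fun x => hM _, fun x y _ _ => ?_⟩, ?_⟩
  · simpa [Real.dist_eq] using hL.dist_le_mul (levelRadius k (levelFun ϱ₀ ϱ₁) (ϱ₁ x))
      (levelRadius k (levelFun ϱ₀ ϱ₁) (ϱ₁ y))
  · rw [eLpNorm_map_measure
      (hφm.aestronglyMeasurable.sub hψd.continuous.aestronglyMeasurable) hRm.aemeasurable] at hψ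
    rw [eLpNorm_sub_comm]
    refine (eLpNorm_congr_ae ?_).trans_le hψ
    filter_upwards [hφ] with x hx
    simp only [Pi.sub_apply, Function.comp_apply, hx]

theorem deviationNorm_sliceKernel_le [IsProbabilityMeasure π] (h₀ : Measurable ϱ₀)
    (h₁ : Measurable ϱ₁) (hfac : ∀ x, ϱ x = ϱ₀ x * ϱ₁ x) (hπ : HasDensity π ϱ) (hk : 0 < k)
    (hℓ : MemLambda k (levelFun ϱ₀ ϱ₁)) :
    deviationNorm π (sliceKernel ϱ₀ ϱ₁) ≤ ENNReal.ofReal (k / (k + 1)) := by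
  refine deviationNorm_le (sliceKernel_isReversible h₀ h₁ hfac hπ) (by positivity)
    (D := {f | ∃ L M, 0 ≤ L ∧ IsRadialLipschitz k ϱ₀ ϱ₁ L M f}) ?_ ?_ ?_
  · rintro f ⟨L, M, -, hf⟩
    exact MemLp.of_bound hf.measurable.aestronglyMeasurable M (Eventually.of_forall hf.norm_le)
  · rintro f ⟨L, M, hL, hf⟩
    exact hf.exists_abs_correlation_le h₀ h₁ hfac hπ hk hℓ hL
  · intro g hg ε hε
    obtain ⟨L, M, f, hL, hf, hle⟩ :=
      exists_isRadialLipschitz_eLpNorm_sub_le h₀ h₁ hfac hπ hk hℓ hg hε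
    exact ⟨f, ⟨L, M, hL, hf⟩, hle⟩

end Mixing

end SliceSampling

theorem theorem3p3 {d : ℕ} (π : Measure (EuclideanSpace ℝ (Fin d))) [IsProbabilityMeasure π]
    (ϱ ϱ₀ ϱ₁ : EuclideanSpace ℝ (Fin d) → ℝ≥0)
    (hϱ₀ : Measurable ϱ₀) (hϱ₁ : Measurable ϱ₁)
    (hfac : ∀ x, ϱ x = ϱ₀ x * ϱ₁ x)
    (hπ : SliceSampling.HasDensity π ϱ)
    (k : ℝ) (hk : 0 < k)
    (hℓ : SliceSampling.MemLambda k (SliceSampling.levelFun ϱ₀ ϱ₁)) :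
    ((1 / (k + 1) : ℝ) : EReal) ≤
      SliceSampling.spectralGap π (SliceSampling.sliceKernel ϱ₀ ϱ₁) := by
  have h := SliceSampling.deviationNorm_sliceKernel_le hϱ₀ hϱ₁ hfac hπ hk hℓ
  have h' : ((SliceSampling.deviationNorm π (SliceSampling.sliceKernel ϱ₀ ϱ₁) : ℝ≥0∞) : EReal)
      ≤ ((k / (k + 1) : ℝ) : EReal) := by
    refine (EReal.coe_ennreal_le_coe_ennreal_iff.2 h).trans_eq ?_
    rw [EReal.coe_ennreal_ofReal, max_eq_left (by positivity)]
  rw [SliceSampling.spectralGap]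
  refine le_trans (le_of_eq ?_) (EReal.sub_le_sub le_rfl h')
  rw [← EReal.coe_one, ← EReal.coe_sub]
  congr 1
  field_simp
  ring
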